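/- Let $\mathcal N=\mathbb Z^d$ or $\mathbb N^d$ with $d\ge 1$ ($\mathbb N$ with or without $0$), let $|a|=\max(1,a_1^2+\cdots+a_d^2)^{1/2}$ for $a\in\mathcal N$, let $\mathcal Z=\mathcal N\times\{\pm1\}$, and for $j=(a,\delta)\in\mathcal Z$ put $|j|=|a|$ and $\bar j=(a,-\delta)$. Let $\ell^1=\ell^1(\mathcal Z,\mathbb C)$ with norm $\|z\|_{\ell^1}=\sum_{j\in\mathcal Z}|z_j|$; write $z=(\xi,\eta)$ with $\xi_a=z_{(a,1)}$, $\eta_a=z_{(a,-1)}$; call $z$ real if $z_{\bar j}=\overline{z_j}$ for all $j$ (i.e. $\eta=\bar\xi$); and put $\|z\|_{H^{s}}=\big(\sum_{j}|j|^{2s}|z_j|^2\big)^{1/2}$. For $r_0\ge 3$, let $\mathcal P_{r_0}$ be the set of polynomials $$P(z)=\sum_{\ell=2}^{r_0}\ \sum_{\boldsymbol j=(j_1,\dots,j_\ell)\in\mathcal Z^\ell} a_{\boldsymbol j}\,z_{j_1}\cdots z_{j_\ell}$$ whose coefficients are bounded, satisfy $a_{\bar{\boldsymbol j}}=\overline{a_{\boldsymbol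 j}}$ (where $\bar{\boldsymbol j}=(\bar j_1,\dots,\bar j_\ell)$), and vanish unless $\boldsymbol j=((a_1,\delta_1),\dots,(a_\ell,\delta_\ell))$ has zero momentum $\delta_1a_1+\cdots+\delta_\ell a_\ell=0$; put $\|P\|=\sum_{\ell=2}^{r_0}\sup_{\boldsymbol j\in\mathcal Z^\ell}|a_{\boldsymbol j}|$. Let $\Phi_P^t$ be the flow on $\ell^1$ of the Hamiltonian system $\dot\xi_a=-i\,\partial P/\partial\eta_a$, $\dot\eta_a=i\,\partial P/\partial\xi_a$. For $h>0$ let $\alpha_h(x)=\sqrt h\,\arctan(x/\sqrt h)$, and for frequencies $\omega=(\omega_a)_{a\in\mathcal N}$ let $\Phi_{A_0}^1$ be the time-one flow of the Hamiltonian $\sum_a\lambda_a\xi_a\eta_a$ with $\lambda_a=\alpha_h(h\omega_a)$, that is, $\big(\Phi^1_{A_0}(z)\big)_{(a,\delta)}=e^{-i\delta\lambda_a}z_{(a,\delta)}$. Let $d$, $\mathcal N$, $r_0\ge3$, $m>0$, $b\ge1$ and real numbers $K,M,R$ be given. Then there exist constants $C,\alpha,c>0$, depending only on these data, such that the following holds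 with $\beta=1/2$. Let $\omega$ satisfy $$\tfrac1b|a|^m\le\omega_a\le b|a|^m\qquad\text{for all }a\in\mathcal N,$$ let $P\in\mathcal P_{r_0}$ with $\|P\|\le K$, let $h>0$, let $z^0=(\xi^0,\overline{\xi^0})\in\ell^1\cap H^{m/2}$ be real with $\|z^0\|_{H^{m/2}}\le R$, and suppose that the sequence $z^{n+1}=\Phi_P^h\circ\Phi_{A_0}^1(z^n)$, $n\ge0$, is defined in $\ell^1$ and satisfies $\|z^n\|_{\ell^1}\le M$ for all $n\ge 0$. Then for every $n\ge 0$ with $nh\le\exp(c\,h^{-\beta})$, $$\sum_{|j|<\alpha h^{-1/(2m)}}|j|^{m}|z_j^n|^2+\frac1{\sqrt h}\sum_{|j|\ge\alpha h^{-1/(2m)}}|z_j^n|^2\le C ,$$ and in particular both sums converge. -/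

import Mathlib

open scoped ComplexConjugate

noncomputable section

/-- The admissible index sets `𝒩`: `ℤ^d`, or `ℕ^d` seen inside `ℤ^d`, where `ℕ` may or may not
contain `0`. -/
def IsModeLattice {d : ℕ} (N : Set (Fin d → ℤ)) : Prop :=
  N = Set.univ ∨ N = {a | ∀ i, 0 ≤ a i} ∨ N = {a | ∀ i, 1 ≤ a i}

/-- `|a|`, where `|a|² = max (1, a₁² + ⋯ + a_d²)`. -/
def latticeAbs {d : ℕ} (a : Fin d → ℤ) : ℝ :=
  Real.sqrt (max 1 (∑ i, (a i : ℝ) ^ 2))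

/-- The index set `𝒵 = 𝒩 × {±1}`. -/
abbrev Mode {d : ℕ} (N : Set (Fin d → ℤ)) : Type := N × ℤˣ

namespace Mode

variable {d : ℕ} {N : Set (Fin d → ℤ)}

/-- `|j| = |a|` for `j = (a, δ)`. -/
def abs (j : Mode N) : ℝ := latticeAbs (j.1 : Fin d → ℤ)

/-- `j̄ = (a, -δ)` for `j = (a, δ)`. -/
def bar (j : Mode N) : Mode N := (j.1, -j.2)

/-- The momentum `δ₁ a₁ + ⋯ + δ_ℓ a_ℓ` of a multi-index `(j₁, …, j_ℓ)`. -/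
def momentum {l : ℕ} (j : Fin l → Mode N) : Fin d → ℤ :=
  ∑ i, ((j i).2 : ℤ) • ((j i).1 : Fin d → ℤ)

end Mode

/-- The phase space `ℓ¹(𝒵, ℂ)` with its norm `‖z‖ = ∑ |z_j|`. A point `z = (ξ, η)` has
`ξ_a = z (a, 1)` and `η_a = z (a, -1)`. -/
abbrev EllOne {d : ℕ} (N : Set (Fin d → ℤ)) : Type := lp (fun _ : Mode N => ℂ) 1

/-- `z` is real when `z_{j̄}` is the conjugate of `z_j`, that is `z = (ξ, ξ̄)`. -/
def IsRealPoint {d : ℕ} {N : Set (Fin d → ℤ)} (z : EllOne N) : Prop :=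
  ∀ j : Mode N, z j.bar = conj (z j)

/-- `z ∈ H^s`, that is `∑ |j|^{2s} |z_j|² < ∞`. -/
def MemSobolev {d : ℕ} {N : Set (Fin d → ℤ)} (s : ℝ) (z : EllOne N) : Prop :=
  Summable fun j : Mode N => j.abs ^ (2 * s) * ‖z j‖ ^ 2

/-- The `H^s` norm `(∑ |j|^{2s} |z_j|²)^{1/2}`. -/
def sobolevNorm {d : ℕ} {N : Set (Fin d → ℤ)} (s : ℝ) (z : EllOne N) : ℝ :=
  Real.sqrt (∑' j : Mode N, j.abs ^ (2 * s) * ‖z j‖ ^ 2)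

/-- The class `𝒫_k` of real polynomial Hamiltonians of degree (at most) `k`, with a zero of order
at least two at the origin, with bounded coefficients and with zero momentum:
`P(z) = ∑_{ℓ = 2}^k ∑_{j ∈ 𝒵^ℓ, momentum j = 0} a_j z_{j₁} ⋯ z_{j_ℓ}`. -/
structure PolyHam {d : ℕ} (N : Set (Fin d → ℤ)) (k : ℕ) where
  coeff : ∀ l : ℕ, (Fin l → Mode N) → ℂ
  degree : ∀ l j, coeff l j ≠ 0 → 2 ≤ l ∧ l ≤ k
  zero_momentum : ∀ l j, coeff l j ≠ 0 → Mode.momentum j = 0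
  coeff_bar : ∀ l j, coeff l (fun i => (j i).bar) = conj (coeff l j)
  bounded : ∀ l, ∃ C : ℝ, ∀ j, ‖coeff l j‖ ≤ C

namespace PolyHam

variable {d : ℕ} {N : Set (Fin d → ℤ)} {k : ℕ}

/-- The value `P(z)`; the series converge absolutely on `ℓ¹`. -/
def eval (P : PolyHam N k) (z : EllOne N) : ℂ :=
  ∑ l ∈ Finset.Icc 2 k, ∑' j : Fin l → Mode N, P.coeff l j * ∏ i, z (j i)

/-- `‖P‖ = ∑_{ℓ = 2}^k sup_j |a_j|`. -/
def norm (P : PolyHam N k) : ℝ :=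
  ∑ l ∈ Finset.Icc 2 k, ⨆ j : Fin l → Mode N, ‖P.coeff l j‖

open Classical in
/-- The partial derivative `∂P/∂z_j` at `z`. -/
def partialDeriv (P : PolyHam N k) (z : EllOne N) (j : Mode N) : ℂ :=
  lineDeriv ℂ P.eval z (lp.single 1 j (1 : ℂ))

/-- The Hamiltonian vector field: `ξ̇_a = -i ∂P/∂η_a`, `η̇_a = i ∂P/∂ξ_a`. -/
def vectorField (P : PolyHam N k) (z : EllOne N) (j : Mode N) : ℂ :=
  -Complex.I * ((j.2 : ℤ) : ℂ) * P.partialDeriv z j.bar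

/-- `w = Φ_P^t(z)`: the Hamiltonian system of `P` has a solution in `ℓ¹` on `[0, t]` which starts
at `z` and ends at `w`. -/
def IsFlow (P : PolyHam N k) (t : ℝ) (z w : EllOne N) : Prop :=
  ∃ u v : ℝ → EllOne N, u 0 = z ∧ u t = w ∧
    ∀ s ∈ Set.Icc 0 t,
      (∀ j, v s j = P.vectorField (u s) j) ∧ HasDerivWithinAt u (v s) (Set.Icc 0 t) s

end PolyHam

/-- The time-one flow of the quadratic Hamiltonian `∑_a λ_a ξ_a η_a`, for the same sign convention
`ξ̇_a = -i λ_a ξ_a`, `η̇_a = i λ_a η_a`: it multiplies `z_{(a, δ)}` by `exp (-i δ λ_a)`. -/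
def linearFlow {d : ℕ} {N : Set (Fin d → ℤ)} (lam : N → ℝ) (z : EllOne N) : EllOne N :=
  ⟨fun j => Complex.exp (-Complex.I * ((j.2 : ℤ) : ℂ) * (lam j.1 : ℂ)) * z j, by
    have hz := lp.memℓp z
    refine memℓp_gen ?_
    have h := hz.summable (by norm_num)
    refine h.congr fun j => ?_
    have he : ‖Complex.exp (-Complex.I * ((j.2 : ℤ) : ℂ) * (lam j.1 : ℂ))‖ = 1 := by
      have := Complex.norm_exp_ofReal_mul_I (-((j.2 : ℤ) : ℝ) * lam j.1)
      rw [← this]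
      congr 2
      push_cast
      ring
    rw [norm_mul, he, one_mul]⟩

/-- The filter function `α_h(x) = √h arctan (x / √h)`. -/
def filterFun (h x : ℝ) : ℝ := Real.sqrt h * Real.arctan (x / Real.sqrt h)

/-- `z^{n+1} = Φ_P^h ∘ Φ_{A₀}^1 (z^n)` for all `n ≥ 0`, where `A₀` has the eigenvalues
`λ_a = α_h(h ω_a)`. -/
def IsSplittingTrajectory {d : ℕ} {N : Set (Fin d → ℤ)} {k : ℕ} (P : PolyHam N k) (ω : N → ℝ)
    (h : ℝ) (z : ℕ → EllOne N) : Prop :=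
  ∀ n, P.IsFlow h (linearFlow (fun a => filterFun h (h * ω a)) (z n)) (z (n + 1))

end

/-! The filter bounds every phase: `|λ_a| ≤ 2√h`. On a ball of `ℓ¹`, one step `F` of the method is
therefore a holomorphic map at distance `ε = O(√h)` from the identity, however large the frequencies
are. It is also exact symplectic: for some holomorphic `S` of size `O(h)`, `dS = ½B(F, DF ·) - ½B(x,
·)`, where `B` is the symplectic form.

Such a map has a modified energy conserved up to an exponentially small error. Let `T f = f ∘ F`,
and let `log T` be its Mercator series in `T - 1`, truncated after `n` terms. Put `X = (log T) id`
and `I = ½B(x, X) - (log T / (T - 1)) S`. If `log T` were exactly a derivation along `X`, then `X ∘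
F = (log T) F = DF X` and `(log T) S = dS(X)`, and exactness would give `I ∘ F = I`.

The truncated logarithm is a derivation up to `O(2⁻ⁿ)` as long as `nε` is small compared with the
radius (`norm_fderiv_koopmanLog_sub_le`). Indeed, let `γ` be the Newton interpolation polynomial of
`j ↦ F^j x`. Then `f ∘ γ` and the Newton polynomial of `j ↦ f (F^j x)` agree at `0, …, n`, both are
bounded on the disc of radius `4n`, and their derivatives at `0` are the two sides to be compared. A
holomorphic function with that many zeros has a tiny derivative at `0`
(`norm_deriv_zero_le_of_zeros`). With `n` of order `1/√h`, the drift of `I` over `exp(c/√h)/h` steps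
is still `O(h)` (`norm_modifiedEnergy_comp_sub_le`, `steps_mul_error_le`).

At a real point `I` is `(i/2) ∑ λ_j |z_j|²` up to `O(h)` (`exists_almost_invariant`). Since `λ_a =
√h arctan(√h ω_a)` is bounded below by a multiple of `h min(|a|^m, 1/√h)` and above by `h ω_a`,
dividing by `h` turns near conservation of this sum into the claim
(`weighted_sums_le_quadraticAction`). Step sizes bounded below are covered by the `ℓ¹` bound alone.
-/

section

open Finset Metric

/-! ### Newton interpolation along the iterates of a near-identity map -/

section Newton

/-- The binomial coefficient `t (t - 1) ⋯ (t - k + 1) / k!` of a complex number. -/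
noncomputable def newtonBinom (t : ℂ) (k : ℕ) : ℂ :=
  (∏ i ∈ range k, (t - i)) / (k.factorial : ℂ)

theorem newtonBinom_natCast (j k : ℕ) : newtonBinom (j : ℂ) k = (j.choose k : ℂ) := by
  rw [newtonBinom, div_eq_iff (by exact_mod_cast k.factorial_ne_zero),
    ← descPochhammer_eval_eq_prod_range, descPochhammer_eval_eq_descFactorial,
    Nat.descFactorial_eq_factorial_mul_choose]
  push_cast
  ring

theorem differentiable_newtonBinom (k : ℕ) : Differentiable ℂ fun t => newtonBinom t k := by
  unfold newtonBinom
  fun_prop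

/-- These are the coefficients of `log (1 + x)`, which is why differentiating a Newton polynomial at
`0` produces the truncated logarithm. -/
theorem hasDerivAt_newtonBinom_succ (k : ℕ) :
    HasDerivAt (fun t => newtonBinom t (k + 1)) ((-1) ^ k / ((k : ℂ) + 1)) 0 := by
  have h : (fun t : ℂ => newtonBinom t (k + 1)) = fun t : ℂ =>
      t * ((∏ i ∈ range k, (t - ((i + 1 : ℕ) : ℂ))) / ((k + 1).factorial : ℂ)) := by
    funext t
    rw [newtonBinom, prod_range_succ']
    simp
    ring
  have hd : Differentiable ℂ fun t : ℂ =>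
      (∏ i ∈ range k, (t - ((i + 1 : ℕ) : ℂ))) / ((k + 1).factorial : ℂ) := by fun_prop
  rw [h]
  refine ((hasDerivAt_id (0 : ℂ)).fun_mul (hd 0).hasDerivAt).congr_deriv ?_
  have h2 : ∏ i ∈ range k, ((0 : ℂ) - ((i + 1 : ℕ) : ℂ)) = (-1) ^ k * (k.factorial : ℂ) := by
    rw [← prod_range_add_one_eq_factorial]
    push_cast
    rw [← card_range k, ← prod_const, card_range, ← prod_mul_distrib]
    exact prod_congr rfl fun i _ => by ring
  have h3 : (k.factorial : ℂ) ≠ 0 := by exact_mod_cast k.factorial_ne_zero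
  have h4 : (k : ℂ) + 1 ≠ 0 := by exact_mod_cast k.succ_ne_zero
  rw [one_mul, id, zero_mul, add_zero, h2, Nat.factorial_succ]
  push_cast
  field_simp

theorem norm_newtonBinom_le {t : ℂ} {n k : ℕ} (ht : ‖t‖ ≤ 4 * n) (hk : k ≤ n) :
    ‖newtonBinom t k‖ ≤ (5 * n) ^ k / k.factorial := by
  rw [newtonBinom, norm_div, norm_prod, Complex.norm_natCast]
  gcongr
  rw [← card_range k, ← prod_const, card_range]
  refine prod_le_prod (fun _ _ => norm_nonneg _) fun i hi => ?_
  have hi' : (i : ℝ) ≤ n := by exact_mod_cast (mem_range.1 hi).le.trans hk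
  calc ‖t - i‖ ≤ ‖t‖ + ‖(i : ℂ)‖ := norm_sub_le _ _
    _ ≤ 5 * n := by rw [Complex.norm_natCast]; linarith

theorem natCast_pow_div_factorial_le (k : ℕ) : (k : ℝ) ^ k / k.factorial ≤ 3 ^ k := by
  refine (Real.pow_div_factorial_le_exp k (by positivity) k).trans ?_
  rw [← mul_one (k : ℝ), Real.exp_nat_mul]
  gcongr
  exact Real.exp_one_lt_three.le

variable {G : Type*} [NormedAddCommGroup G] [NormedSpace ℂ G] [CompleteSpace G]

/-- Each zero `j` is divided out with `dslope`: on the circle this costs at most a factor `1 / (ρ -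
j)`, and at `0` it returns a factor `j`. The maximum principle closes the induction once no zeros
remain. -/
theorem norm_zero_le_of_zeros {ρ R : ℝ} (hR : ρ < R) (n : ℕ) (hn : (n : ℝ) < ρ) :
    ∀ (f : ℂ → G) (b : ℝ), DifferentiableOn ℂ f (ball 0 R) →
      (∀ j ∈ Icc 1 n, f (j : ℂ) = 0) → (∀ t, ‖t‖ = ρ → ‖f t‖ ≤ b) →
      ‖f 0‖ ≤ b * ∏ j ∈ Icc 1 n, ((j : ℝ) / (ρ - j)) := by
  induction n with
  | zero =>
    intro f b hf _ hb
    have hρ : 0 < ρ := by simpa using hn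
    simp only [zero_lt_one, Icc_eq_empty_of_lt, prod_empty, mul_one]
    refine Complex.norm_le_of_forall_mem_frontier_norm_le (U := ball 0 ρ) isBounded_ball
      (hf.diffContOnCl_ball (closedBall_subset_ball hR)) (fun z hz => hb z ?_)
      (subset_closure (mem_ball_self hρ))
    rw [frontier_ball _ hρ.ne'] at hz
    simpa using hz
  | succ n ih =>
    intro f b hf hz hb
    push_cast at hn
    have hpos : 0 < ρ - (n + 1 : ℝ) := by linarith
    set p : ℂ := ((n + 1 : ℕ) : ℂ) with hp
    have hpn : ‖p‖ = n + 1 := by rw [hp, Complex.norm_natCast]; push_cast; ring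
    have hpR : ball (0 : ℂ) R ∈ nhds p :=
      isOpen_ball.mem_nhds (by rw [mem_ball_zero_iff, hpn]; linarith)
    have hfp : f p = 0 := hz (n + 1) (by simp)
    have key := ih (by linarith) (dslope f p) (b / (ρ - (n + 1)))
      ((Complex.differentiableOn_dslope hpR).2 hf) ?_ ?_
    · have h0 : f 0 = ((0 : ℂ) - p) • dslope f p 0 := by
        rw [sub_smul_dslope, hfp, sub_zero]
      rw [h0, norm_smul, zero_sub, norm_neg, hpn, prod_Icc_succ_top (by omega)]
      calc (n + 1 : ℝ) * ‖dslope f p 0‖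
          ≤ (n + 1) * (b / (ρ - (n + 1)) * ∏ j ∈ Icc 1 n, ((j : ℝ) / (ρ - j))) := by gcongr
        _ = _ := by push_cast; ring
    · intro j hj
      have hj' := mem_Icc.1 hj
      have hne : (j : ℂ) ≠ p := by
        rw [hp]; exact_mod_cast (by omega : j ≠ n + 1)
      rw [dslope_of_ne _ hne, slope_def_module, hfp, hz j (mem_Icc.2 (by omega))]
      simp
    · intro t ht
      have hge : ρ - (n + 1) ≤ ‖t - p‖ := by
        have := norm_sub_norm_le t p
        rw [ht, hpn] at this
        exact this
      have hne : t ≠ p := by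
        rintro rfl
        simp only [sub_self, norm_zero] at hge
        linarith
      rw [dslope_of_ne _ hne, slope_def_module, hfp, sub_zero, norm_smul, norm_inv,
        inv_mul_eq_div]
      have hb0 : 0 ≤ b := (norm_nonneg _).trans (hb t ht)
      gcongr
      exact hb t ht

theorem norm_deriv_zero_le_of_zeros {n : ℕ} (hn : 1 ≤ n) {f : ℂ → G} {b : ℝ}
    (hf : DifferentiableOn ℂ f (ball 0 (4 * n))) (hz : ∀ j ≤ n, f (j : ℂ) = 0)
    (hb : ∀ t ∈ ball (0 : ℂ) (4 * n), ‖f t‖ ≤ b) : ‖deriv f 0‖ ≤ b * (1 / 2) ^ n := by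
  have hn' : (1 : ℝ) ≤ n := by exact_mod_cast hn
  have hf0 : f 0 = 0 := by simpa using hz 0 (Nat.zero_le _)
  have hb0 : 0 ≤ b := (norm_nonneg _).trans (hb 0 (mem_ball_self (by linarith)))
  -- The zero at the origin is divided out first, so the value of the quotient at `0` is the
  -- derivative. On the circle of radius `3n` each remaining zero contributes `j / (3n - j) ≤ 1/2`.
  have key := norm_zero_le_of_zeros (ρ := 3 * n) (R := 4 * n) (by linarith) n (by linarith)
    (dslope f 0) b ((Complex.differentiableOn_dslope
      (isOpen_ball.mem_nhds (mem_ball_self (by linarith)))).2 hf) ?_ ?_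
  · rw [dslope_same] at key
    refine key.trans ?_
    gcongr
    calc ∏ j ∈ Icc 1 n, ((j : ℝ) / (3 * n - j)) ≤ ∏ j ∈ Icc 1 n, (1 / 2 : ℝ) := by
          refine prod_le_prod (fun j hj => ?_) fun j hj => ?_
          · have : (j : ℝ) ≤ n := by exact_mod_cast (mem_Icc.1 hj).2
            exact div_nonneg (by positivity) (by linarith)
          · have : (j : ℝ) ≤ n := by exact_mod_cast (mem_Icc.1 hj).2
            rw [div_le_div_iff₀ (by linarith) two_pos]
            linarith
      _ = _ := by simp
  · intro j hj
    have hj' := mem_Icc.1 hj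
    have hne : (j : ℂ) ≠ 0 := by exact_mod_cast (by omega : j ≠ 0)
    rw [dslope_of_ne _ hne, slope_def_module, hf0, hz j hj'.2]
    simp
  · intro t ht
    have hne : t ≠ 0 := by
      rintro rfl
      rw [norm_zero] at ht
      linarith
    rw [dslope_of_ne _ hne, slope_def_module, hf0, sub_zero, sub_zero, norm_smul, norm_inv, ht,
      inv_mul_eq_div]
    refine (div_le_self (norm_nonneg _) (by linarith)).trans (hb t ?_)
    rw [mem_ball_zero_iff, ht]
    linarith

end Newton

/-! ### Finite differences and the truncated logarithm of the composition operator -/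

section Koopman

section Algebraic

variable {E G : Type*} [AddCommGroup G]

/-- The operator `f ↦ f ∘ F - f`. -/
def koopmanDiff (F : E → E) (f : E → G) : E → G := fun x => f (F x) - f x

theorem koopmanDiff_iterate_comp (F : E → E) (f : E → G) (k : ℕ) (x : E) :
    (koopmanDiff F)^[k] (fun y => f (F y)) x = (koopmanDiff F)^[k] f (F x) := by
  induction k generalizing x with
  | zero => rfl
  | succ k ih =>
    rw [Function.iterate_succ_apply', Function.iterate_succ_apply']
    simp only [koopmanDiff, ih]

theorem fwdDiff_iterate_eq_koopmanDiff (F : E → E) (f : E → G) (x : E) (k i : ℕ) :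
    (fwdDiff (1 : ℕ))^[k] (fun j => f (F^[j] x)) i = (koopmanDiff F)^[k] f (F^[i] x) := by
  induction k generalizing i with
  | zero => rfl
  | succ k ih =>
    rw [Function.iterate_succ_apply', Function.iterate_succ_apply', fwdDiff, ih, ih, koopmanDiff,
      Function.iterate_succ_apply']

variable [Module ℂ G]

/-- The Newton interpolation polynomial of degree `n` of `j ↦ f (F^j x)`. -/
noncomputable def newtonCurve (F : E → E) (f : E → G) (n : ℕ) (x : E) (t : ℂ) : G :=
  ∑ k ∈ range (n + 1), newtonBinom t k • (koopmanDiff F)^[k] f x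

/-- The truncated logarithm `∑_{k < n} (-1)^k / (k + 1) (T - 1)^{k + 1} f`, where `T f = f ∘ F`. -/
noncomputable def koopmanLog (F : E → E) (f : E → G) (n : ℕ) (x : E) : G :=
  ∑ k ∈ range n, ((-1 : ℂ) ^ k / ((k : ℂ) + 1)) • (koopmanDiff F)^[k + 1] f x

/-- The truncation `∑_{k < n} (-1)^k / (k + 1) (T - 1)^k f` of `log T / (T - 1)`. -/
noncomputable def koopmanLogDiv (F : E → E) (f : E → G) (n : ℕ) (x : E) : G :=
  ∑ k ∈ range n, ((-1 : ℂ) ^ k / ((k : ℂ) + 1)) • (koopmanDiff F)^[k] f x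

/-- Applying `T - 1` raises every power of `T - 1` by one. -/
theorem koopmanLogDiv_comp_sub (F : E → E) (f : E → G) (n : ℕ) (x : E) :
    koopmanLogDiv F f n (F x) - koopmanLogDiv F f n x = koopmanLog F f n x := by
  rw [koopmanLogDiv, koopmanLogDiv, koopmanLog, ← sum_sub_distrib]
  refine sum_congr rfl fun k _ => ?_
  rw [Function.iterate_succ_apply', koopmanDiff, smul_sub]

/-- `T` commutes with powers of `T - 1`. For `f = id` this identifies `X ∘ F` with the logarithm
applied to `F`. -/
theorem koopmanLog_comp (F : E → E) (f : E → G) (n : ℕ) (x : E) :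
    koopmanLog F (fun y => f (F y)) n x = koopmanLog F f n (F x) := by
  simp only [koopmanLog, koopmanDiff_iterate_comp]

/-- Newton's forward difference formula; terms of order above `j` vanish because the binomial
coefficients do. -/
theorem newtonCurve_natCast (F : E → E) (f : E → G) {n j : ℕ} (hj : j ≤ n) (x : E) :
    newtonCurve F f n x j = f (F^[j] x) := by
  have h := shift_eq_sum_fwdDiff_iter (1 : ℕ) (fun j => f (F^[j] x)) j 0
  simp only [smul_eq_mul, mul_one, zero_add, fwdDiff_iterate_eq_koopmanDiff] at h
  rw [h, newtonCurve]
  symm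
  have hsub : range (j + 1) ⊆ range (n + 1) := range_subset_range.2 (by omega)
  rw [← sum_subset hsub]
  · refine sum_congr rfl fun k _ => ?_
    rw [newtonBinom_natCast, Nat.cast_smul_eq_nsmul]
    rfl
  · intro k _ hk
    rw [newtonBinom_natCast, Nat.choose_eq_zero_of_lt (by simpa using hk), Nat.cast_zero, zero_smul]

end Algebraic

section Calculus

variable {E G : Type*} [NormedAddCommGroup G] [NormedSpace ℂ G]

theorem differentiable_newtonCurve (F : E → E) (f : E → G) (n : ℕ) (x : E) :
    Differentiable ℂ (newtonCurve F f n x) := by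
  unfold newtonCurve
  refine Differentiable.fun_sum fun k _ => ?_
  exact (differentiable_newtonBinom k).smul_const _

theorem hasDerivAt_newtonCurve (F : E → E) (f : E → G) (n : ℕ) (x : E) :
    HasDerivAt (newtonCurve F f n x) (koopmanLog F f n x) 0 := by
  have h : newtonCurve F f n x = fun t =>
      (∑ k ∈ range n, newtonBinom t (k + 1) • (koopmanDiff F)^[k + 1] f x) + f x := by
    funext t
    rw [newtonCurve, sum_range_succ']
    simp [newtonBinom]
  rw [h]
  refine HasDerivAt.add_const _ (HasDerivAt.fun_sum fun k _ => ?_)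
  exact (hasDerivAt_newtonBinom_succ k).smul_const _

end Calculus

variable {E G : Type*} [NormedAddCommGroup E] [NormedSpace ℂ E]
  [NormedAddCommGroup G] [NormedSpace ℂ G] {F : E → E} {r ε : ℝ}

/-- By the Schwarz lemma on a ball of radius `δ` around `x`, moving from `x` to `F x` changes a
function bounded by `B` by at most `2Bε/δ`. Each difference thus costs `δ` of radius and gains the
factor `2ε/δ`. -/
theorem koopmanDiff_iterate_bound (hF : DifferentiableOn ℂ F (ball 0 r))
    (hε : ∀ x ∈ ball (0 : E) r, ‖F x - x‖ ≤ ε) {f : E → G} {b : ℝ}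
    (hf : DifferentiableOn ℂ f (ball 0 r)) (hb : ∀ x ∈ ball (0 : E) r, ‖f x‖ ≤ b)
    {δ : ℝ} (hδ : ε < δ) (hδ0 : 0 < δ) (i : ℕ) :
    DifferentiableOn ℂ ((koopmanDiff F)^[i] f) (ball 0 (r - i * δ)) ∧
      ∀ x ∈ ball (0 : E) (r - i * δ), ‖(koopmanDiff F)^[i] f x‖ ≤ b * (2 * ε / δ) ^ i := by
  induction i with
  | zero => simpa using ⟨hf, by simpa using hb⟩
  | succ i ih =>
    obtain ⟨ih1, ih2⟩ := ih
    rw [Function.iterate_succ_apply']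
    set g := (koopmanDiff F)^[i] f
    have hsub : ball (0 : E) (r - (i + 1 : ℕ) * δ) ⊆ ball 0 r := by
      refine ball_subset_ball ?_
      have : 0 ≤ ((i + 1 : ℕ) : ℝ) * δ := by positivity
      linarith
    have hsub' : ball (0 : E) (r - (i + 1 : ℕ) * δ) ⊆ ball 0 (r - i * δ) := by
      refine ball_subset_ball ?_
      push_cast
      linarith
    have hxδ : ∀ x ∈ ball (0 : E) (r - (i + 1 : ℕ) * δ), ball x δ ⊆ ball 0 (r - i * δ) := by
      intro x hx
      refine ball_subset_ball' ?_
      rw [mem_ball] at hx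
      push_cast at hx
      linarith
    have hFx : ∀ x ∈ ball (0 : E) (r - (i + 1 : ℕ) * δ), F x ∈ ball x δ := fun x hx => by
      rw [mem_ball, dist_eq_norm]
      exact (hε x (hsub hx)).trans_lt hδ
    refine ⟨?_, fun x hx => ?_⟩
    · exact (ih1.comp (hF.mono hsub) fun x hx => hxδ x hx (hFx x hx)).sub (ih1.mono hsub')
    · have h := Complex.dist_le_div_mul_dist_of_mapsTo_ball (R₂ := 2 * (b * (2 * ε / δ) ^ i))
        (ih1.mono (hxδ x hx)) (fun y hy => ?_) (hFx x hx)
      · rw [dist_eq_norm, dist_eq_norm] at h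
        rw [koopmanDiff]
        refine h.trans ?_
        have hB : 0 ≤ b * (2 * ε / δ) ^ i := (norm_nonneg _).trans (ih2 x (hsub' hx))
        calc 2 * (b * (2 * ε / δ) ^ i) / δ * ‖F x - x‖
            ≤ 2 * (b * (2 * ε / δ) ^ i) / δ * ε := by
              gcongr
              exact hε x (hsub hx)
          _ = _ := by ring
      · rw [mem_closedBall, dist_eq_norm]
        refine (norm_sub_le _ _).trans ?_
        have := ih2 y (hxδ x hx hy)
        have := ih2 x (hsub' hx)
        linarith

theorem norm_koopmanDiff_iterate_le (hr : 0 < r) (hF : DifferentiableOn ℂ F (ball 0 r))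
    (hε : ∀ x ∈ ball (0 : E) r, ‖F x - x‖ ≤ ε) {f : E → G} {b : ℝ}
    (hf : DifferentiableOn ℂ f (ball 0 r)) (hb : ∀ x ∈ ball (0 : E) r, ‖f x‖ ≤ b)
    {k : ℕ} (hk : 2 * k * ε < r) {x : E} (hx : x ∈ ball (0 : E) (r / 2)) :
    ‖(koopmanDiff F)^[k] f x‖ ≤ b * (4 * k * ε / r) ^ k := by
  rcases Nat.eq_zero_or_pos k with rfl | hk0
  · simpa using hb x (ball_subset_ball (by linarith) hx)
  have hk' : (0 : ℝ) < k := by exact_mod_cast hk0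
  -- The `k` differences share the loss of half the radius equally.
  have h := (koopmanDiff_iterate_bound hF hε hf hb (δ := r / (2 * k))
    (by rw [lt_div_iff₀ (by positivity)]; linarith) (by positivity) k).2 x ?_
  · convert h using 3
    field_simp
    ring
  · convert hx using 2
    field_simp
    ring

end Koopman

end

section

open Finset Metric

/-! ### Approximate derivation property and the modified energy -/

section ModifiedEnergy

variable {E G : Type*} [NormedAddCommGroup E] [NormedSpace ℂ E]
  [NormedAddCommGroup G] [NormedSpace ℂ G] {F : E → E} {r ε : ℝ}

/-- The growth `(5n)^k / k!` of the binomials meets the decay `(4kε/r)^k` of the differences. As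
`k^k / k! ≤ 3^k`, the product is at most `(60nε/r)^k ≤ 4^{-k}`, which accounts for the constant
`240`. -/
theorem norm_newtonCurve_sub_le (hr : 0 < r) (hF : DifferentiableOn ℂ F (ball 0 r))
    (hε0 : 0 ≤ ε) (hε : ∀ x ∈ ball (0 : E) r, ‖F x - x‖ ≤ ε) {f : E → G} {b : ℝ}
    (hf : DifferentiableOn ℂ f (ball 0 r)) (hb : ∀ x ∈ ball (0 : E) r, ‖f x‖ ≤ b)
    {n : ℕ} (hn : 240 * n * ε ≤ r) {x : E} (hx : x ∈ ball (0 : E) (r / 2)) {t : ℂ}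
    (ht : ‖t‖ ≤ 4 * n) : ‖newtonCurve F f n x t - f x‖ ≤ b / 2 := by
  have hb0 : 0 ≤ b := (norm_nonneg _).trans (hb 0 (mem_ball_self hr))
  have h : newtonCurve F f n x t - f x =
      ∑ k ∈ range n, newtonBinom t (k + 1) • (koopmanDiff F)^[k + 1] f x := by
    rw [newtonCurve, sum_range_succ']
    simp [newtonBinom]
  rw [h]
  have hterm : ∀ k ∈ range n, ‖newtonBinom t (k + 1) • (koopmanDiff F)^[k + 1] f x‖ ≤
      b / 4 * (1 / 2) ^ k := by
    intro k hk
    have hkn : k + 1 ≤ n := by simpa using hk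
    have hkn' : ((k + 1 : ℕ) : ℝ) ≤ n := by exact_mod_cast hkn
    have hkε : ((k + 1 : ℕ) : ℝ) * ε ≤ n * ε := by gcongr
    rw [norm_smul]
    calc ‖newtonBinom t (k + 1)‖ * ‖(koopmanDiff F)^[k + 1] f x‖
        ≤ ((5 * n) ^ (k + 1) / (k + 1).factorial) *
            (b * (4 * (k + 1 : ℕ) * ε / r) ^ (k + 1)) := by
          gcongr
          · exact norm_newtonBinom_le ht hkn
          · exact norm_koopmanDiff_iterate_le hr hF hε hf hb (by nlinarith) hx
      _ = b * (20 * n * ε / r) ^ (k + 1) *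
            (((k + 1 : ℕ) : ℝ) ^ (k + 1) / (k + 1).factorial) := by
          simp only [div_pow, mul_pow]
          rw [show (20 : ℝ) ^ (k + 1) = 5 ^ (k + 1) * 4 ^ (k + 1) by
            rw [← mul_pow]; norm_num]
          ring
      _ ≤ b * (20 * n * ε / r) ^ (k + 1) * 3 ^ (k + 1) := by
          gcongr
          exact natCast_pow_div_factorial_le _
      _ = b * (60 * n * ε / r) ^ (k + 1) := by
          rw [mul_assoc, ← mul_pow]
          ring
      _ ≤ b * (1 / 4) ^ (k + 1) := by
          refine mul_le_mul_of_nonneg_left (pow_le_pow_left₀ (by positivity) ?_ _) hb0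
          rw [div_le_iff₀ hr]
          linarith
      _ = b / 4 * (1 / 4) ^ k := by ring
      _ ≤ b / 4 * (1 / 2) ^ k := by gcongr; norm_num
  calc _ ≤ ∑ k ∈ range n, b / 4 * (1 / 2) ^ k := norm_sum_le_of_le _ hterm
    _ = b / 4 * ∑ k ∈ range n, (1 / 2 : ℝ) ^ k := by rw [mul_sum]
    _ ≤ b / 4 * 2 := by
        gcongr
        exact sum_geometric_two_le n
    _ = b / 2 := by ring

/-- The truncated logarithm of the composition operator is a derivation, up to an exponentially
small error. -/
theorem norm_fderiv_koopmanLog_sub_le [CompleteSpace G] (hr : 0 < r)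
    (hF : DifferentiableOn ℂ F (ball 0 r))
    (hε0 : 0 ≤ ε) (hε : ∀ x ∈ ball (0 : E) r, ‖F x - x‖ ≤ ε) {f : E → G} {b : ℝ}
    (hf : DifferentiableOn ℂ f (ball 0 r)) (hb : ∀ x ∈ ball (0 : E) r, ‖f x‖ ≤ b)
    {n : ℕ} (hn1 : 1 ≤ n) (hn : 240 * n * ε ≤ r) {x : E} (hx : x ∈ ball (0 : E) (r / 2)) :
    ‖fderiv ℂ f x (koopmanLog F id n x) - koopmanLog F f n x‖ ≤ 3 * b * (1 / 2) ^ n := by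
  have hb0 : 0 ≤ b := (norm_nonneg _).trans (hb 0 (mem_ball_self hr))
  have hxr : x ∈ ball (0 : E) r := ball_subset_ball (by linarith) hx
  set γ := newtonCurve F (id : E → E) n x
  have hγ0 : γ 0 = x := by
    simpa using newtonCurve_natCast F (id : E → E) (Nat.zero_le n) x
  have hγ : ∀ t ∈ ball (0 : ℂ) (4 * n), γ t ∈ ball (0 : E) r := by
    intro t ht
    have h1 := norm_newtonCurve_sub_le hr hF hε0 hε differentiableOn_id
      (fun y hy => (mem_ball_zero_iff.1 hy).le) hn hx (mem_ball_zero_iff.1 ht).le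
    rw [mem_ball_zero_iff] at hx ⊢
    have h2 : ‖γ t‖ ≤ ‖γ t - x‖ + ‖x‖ := by simpa using norm_add_le (γ t - x) x
    simp only [id] at h1
    linarith
  have hfx : DifferentiableAt ℂ f x := hf.differentiableAt (isOpen_ball.mem_nhds hxr)
  -- This difference of `f` along the interpolated orbit and the interpolation of `f` along the
  -- orbit vanishes at `0, …, n`; its derivative at `0` is the defect of the derivation property.
  have hderiv : HasDerivAt (fun t => f (γ t) - newtonCurve F f n x t)
      (fderiv ℂ f x (koopmanLog F id n x) - koopmanLog F f n x) 0 := by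
    refine HasDerivAt.sub ?_ (hasDerivAt_newtonCurve F f n x)
    refine HasFDerivAt.comp_hasDerivAt (0 : ℂ) ?_ (hasDerivAt_newtonCurve F id n x)
    change HasFDerivAt f (fderiv ℂ f x) (γ 0)
    rw [hγ0]
    exact hfx.hasFDerivAt
  rw [← hderiv.deriv]
  refine norm_deriv_zero_le_of_zeros hn1 ?_ ?_ ?_
  · exact (hf.comp (differentiable_newtonCurve F id n x).differentiableOn hγ).sub
      (differentiable_newtonCurve F f n x).differentiableOn
  · intro j hj
    rw [newtonCurve_natCast F f hj x, show γ j = F^[j] x from newtonCurve_natCast F id hj x,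
      sub_self]
  · intro t ht
    have h1 := norm_newtonCurve_sub_le hr hF hε0 hε hf hb hn hx (mem_ball_zero_iff.1 ht).le
    have h2 : ‖newtonCurve F f n x t‖ ≤ ‖newtonCurve F f n x t - f x‖ + ‖f x‖ := by
      simpa using norm_add_le (newtonCurve F f n x t - f x) (f x)
    have h3 := hb x hxr
    have h4 := hb _ (hγ t ht)
    have h5 := norm_sub_le (f (γ t)) (newtonCurve F f n x t)
    linarith

/-- The modified energy of an exact symplectic map `F` with generating function `S`. -/
noncomputable def modifiedEnergy (B : E →L[ℂ] E →L[ℂ] ℂ) (F : E → E) (S : E → ℂ) (n : ℕ) (x : E) :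
    ℂ :=
  1 / 2 * B x (koopmanLog F id n x) - koopmanLogDiv F S n x

variable {S : E → ℂ} {σ : ℝ} {B : E →L[ℂ] E →L[ℂ] ℂ}

/-- The derivation property is used twice, for `F` and for `S`; the exactness relation `hFS` cancels
everything but these two defects. -/
theorem norm_modifiedEnergy_comp_sub_le [CompleteSpace E] (hr : 0 < r)
    (hF : DifferentiableOn ℂ F (ball 0 r))
    (hε0 : 0 ≤ ε) (hε : ∀ x ∈ ball (0 : E) r, ‖F x - x‖ ≤ ε)
    (hS : DifferentiableOn ℂ S (ball 0 r)) (hσ : ∀ x ∈ ball (0 : E) r, ‖S x‖ ≤ σ)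
    (hFS : ∀ x ∈ ball (0 : E) r, ∀ v,
      fderiv ℂ S x v = 1 / 2 * B (F x) (fderiv ℂ F x v) - 1 / 2 * B x v)
    {n : ℕ} (hn1 : 1 ≤ n) (hn : 240 * n * ε ≤ r) {x : E} (hx : x ∈ ball (0 : E) (r / 2)) :
    ‖modifiedEnergy B F S n (F x) - modifiedEnergy B F S n x‖ ≤
      (6 * ‖B‖ * r ^ 2 + 3 * σ) * (1 / 2) ^ n := by
  have hxr : x ∈ ball (0 : E) r := ball_subset_ball (by linarith) hx
  have hn1' : (1 : ℝ) ≤ n := by exact_mod_cast hn1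
  have hεr : ε ≤ r := by nlinarith
  have hFb : ∀ y ∈ ball (0 : E) r, ‖F y‖ ≤ 2 * r := by
    intro y hy
    have h2 : ‖F y‖ ≤ ‖F y - y‖ + ‖y‖ := by simpa using norm_add_le (F y - y) y
    have := hε y hy
    have := mem_ball_zero_iff.1 hy
    linarith
  have h1 := norm_fderiv_koopmanLog_sub_le hr hF hε0 hε hF hFb hn1 hn hx
  have h2 := norm_fderiv_koopmanLog_sub_le hr hF hε0 hε hS hσ hn1 hn hx
  have h3 : koopmanLog F F n x = koopmanLog F id n (F x) := koopmanLog_comp F (id : E → E) n x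
  have h4 := koopmanLogDiv_comp_sub F S n x
  set X := koopmanLog F id n x
  have key : modifiedEnergy B F S n (F x) - modifiedEnergy B F S n x =
      -(1 / 2 * B (F x) (fderiv ℂ F x X - koopmanLog F F n x)) +
        (fderiv ℂ S x X - koopmanLog F S n x) := by
    rw [modifiedEnergy, modifiedEnergy, ← h4, hFS x hxr, map_sub, h3]
    ring
  rw [key]
  calc _ ≤ 1 / 2 * (‖B‖ * ‖F x‖ * ‖fderiv ℂ F x X - koopmanLog F F n x‖) +
        ‖fderiv ℂ S x X - koopmanLog F S n x‖ := by
        refine (norm_add_le _ _).trans ?_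
        rw [norm_neg, norm_mul]
        gcongr
        · norm_num
        · exact B.le_opNorm₂ _ _
    _ ≤ 1 / 2 * (‖B‖ * (2 * r) * (3 * (2 * r) * (1 / 2) ^ n)) + 3 * σ * (1 / 2) ^ n := by
        gcongr
        exact hFb x hxr
    _ = _ := by ring

/-- The leading term of the logarithm of `id` is `F x - x`, and the remaining terms form a geometric
series of size `ε² / r`; the factor `r` is recovered from `‖x‖`. The generating function contributes
at most `2σ`. -/
theorem norm_modifiedEnergy_sub_le (hr : 0 < r)
    (hF : DifferentiableOn ℂ F (ball 0 r))
    (hε0 : 0 ≤ ε) (hε : ∀ x ∈ ball (0 : E) r, ‖F x - x‖ ≤ ε)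
    (hS : DifferentiableOn ℂ S (ball 0 r)) (hσ : ∀ x ∈ ball (0 : E) r, ‖S x‖ ≤ σ)
    {n : ℕ} (hn1 : 1 ≤ n) (hn : 240 * n * ε ≤ r) {x : E} (hx : x ∈ ball (0 : E) (r / 2)) :
    ‖modifiedEnergy B F S n x - 1 / 2 * B x (F x - x)‖ ≤ 2 * ‖B‖ * ε ^ 2 + 2 * σ := by
  have hσ0 : 0 ≤ σ := (norm_nonneg _).trans (hσ 0 (mem_ball_self hr))
  have hcoef : ∀ k : ℕ, ‖(-1 : ℂ) ^ k / ((k : ℂ) + 1)‖ = 1 / (k + 1) := by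
    intro k
    rw [norm_div, norm_pow, norm_neg, norm_one, one_pow]
    congr 1
    exact_mod_cast Complex.norm_natCast (k + 1)
  have hhalf : ∀ k ∈ range n, 4 * k * ε / r ≤ 1 / 2 := by
    intro k hk
    have hk' : (k : ℝ) ≤ n := by exact_mod_cast (mem_range.1 hk).le
    rw [div_le_iff₀ hr]
    nlinarith [mul_le_mul_of_nonneg_right hk' hε0]
  have hsmall : ∀ k ∈ range n, 2 * k * ε < r := by
    intro k hk
    have hk' : (k : ℝ) ≤ n := by exact_mod_cast (mem_range.1 hk).le
    nlinarith [mul_le_mul_of_nonneg_right hk' hε0]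
  have h1 : ‖koopmanLogDiv F S n x‖ ≤ 2 * σ := by
    calc ‖koopmanLogDiv F S n x‖ ≤ ∑ k ∈ range n, σ * (1 / 2) ^ k := by
          refine norm_sum_le_of_le _ fun k hk => ?_
          rw [norm_smul, hcoef]
          have h := norm_koopmanDiff_iterate_le hr hF hε hS hσ (hsmall k hk) hx
          calc 1 / ((k : ℝ) + 1) * ‖(koopmanDiff F)^[k] S x‖
              ≤ 1 * ‖(koopmanDiff F)^[k] S x‖ := by
                gcongr
                rw [div_le_one (by positivity)]
                linarith [Nat.cast_nonneg (α := ℝ) k]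
            _ ≤ σ * (4 * k * ε / r) ^ k := by rwa [one_mul]
            _ ≤ _ := by
                exact mul_le_mul_of_nonneg_left
                  (pow_le_pow_left₀ (by positivity) (hhalf k hk) _) hσ0
      _ = σ * ∑ k ∈ range n, (1 / 2 : ℝ) ^ k := by rw [mul_sum]
      _ ≤ σ * 2 := by gcongr; exact sum_geometric_two_le n
      _ = 2 * σ := by ring
  have h2 : ‖koopmanLog F id n x - (F x - x)‖ ≤ 8 * ε ^ 2 / r := by
    obtain ⟨p, rfl⟩ : ∃ p, n = p + 1 := ⟨n - 1, by omega⟩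
    have h : koopmanLog F id (p + 1) x - (F x - x) = ∑ k ∈ range p,
        ((-1 : ℂ) ^ (k + 1) / (((k + 1 : ℕ) : ℂ) + 1)) •
          (koopmanDiff F)^[k + 1] (koopmanDiff F (id : E → E)) x := by
      rw [koopmanLog, sum_range_succ']
      simp [koopmanDiff]
    rw [h]
    calc _ ≤ ∑ k ∈ range p, 4 * ε ^ 2 / r * (1 / 2) ^ k := by
          refine norm_sum_le_of_le _ fun k hk => ?_
          rw [norm_smul, hcoef]
          have hk1 : k + 1 ∈ range (p + 1) := by simpa using hk
          have h := norm_koopmanDiff_iterate_le hr hF hε (f := koopmanDiff F (id : E → E))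
            (hF.sub differentiableOn_id) hε (hsmall _ hk1) hx
          calc 1 / (((k + 1 : ℕ) : ℝ) + 1) *
                ‖(koopmanDiff F)^[k + 1] (koopmanDiff F (id : E → E)) x‖
              ≤ 1 / ((k + 1 : ℕ) : ℝ) * (ε * (4 * (k + 1 : ℕ) * ε / r) ^ (k + 1)) := by
                gcongr
                linarith
            _ = 4 * ε ^ 2 / r * (4 * (k + 1 : ℕ) * ε / r) ^ k := by
                have : ((k + 1 : ℕ) : ℝ) ≠ 0 := by positivity
                rw [pow_succ]
                field_simp
            _ ≤ _ := by
                exact mul_le_mul_of_nonneg_left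
                  (pow_le_pow_left₀ (by positivity) (hhalf _ hk1) _) (by positivity)
      _ = 4 * ε ^ 2 / r * ∑ k ∈ range p, (1 / 2 : ℝ) ^ k := by rw [mul_sum]
      _ ≤ 4 * ε ^ 2 / r * 2 := by gcongr; exact sum_geometric_two_le p
      _ = _ := by ring
  have key : modifiedEnergy B F S n x - 1 / 2 * B x (F x - x) =
      1 / 2 * B x (koopmanLog F id n x - (F x - x)) - koopmanLogDiv F S n x := by
    rw [modifiedEnergy, map_sub (B x) (koopmanLog F id n x)]
    ring
  rw [key]
  have hx' : ‖x‖ ≤ r / 2 := (mem_ball_zero_iff.1 hx).le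
  calc _ ≤ 1 / 2 * (‖B‖ * ‖x‖ * ‖koopmanLog F id n x - (F x - x)‖) +
        ‖koopmanLogDiv F S n x‖ := by
        refine (norm_sub_le _ _).trans ?_
        rw [norm_mul]
        gcongr
        · norm_num
        · exact B.le_opNorm₂ _ _
    _ ≤ 1 / 2 * (‖B‖ * (r / 2) * (8 * ε ^ 2 / r)) + 2 * σ := by gcongr
    _ = _ := by field_simp; ring

end ModifiedEnergy

end

section

open Set Metric
open scoped NNReal Topology

/-! ### Flows of bounded holomorphic vector fields -/

section Flow

variable {V W : Type*} [NormedAddCommGroup V] [NormedSpace ℂ V]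
  [NormedAddCommGroup W] [NormedSpace ℂ W]

/-- Nearby points are handled by the Schwarz lemma on a ball of radius `δ`; for points at distance
at least `δ` the trivial bound `2C` suffices. -/
theorem norm_sub_le_of_norm_le_ball {f : V → W} (hf : Differentiable ℂ f) {R δ C : ℝ} (hδ : 0 < δ)
    (hb : ∀ x, ‖x‖ < R + δ → ‖f x‖ ≤ C) {x y : V} (hx : ‖x‖ ≤ R) (hy : ‖y‖ ≤ R) :
    ‖f y - f x‖ ≤ 2 * C / δ * ‖y - x‖ := by
  have hC : 0 ≤ C := (norm_nonneg _).trans (hb x (by linarith))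
  have hsub : ∀ w, ‖w‖ < R + δ → ‖f w - f x‖ ≤ 2 * C := fun w hw =>
    (norm_sub_le _ _).trans (by linarith [hb w hw, hb x (by linarith)])
  by_cases h : ‖y - x‖ < δ
  · have := Complex.dist_le_div_mul_dist_of_mapsTo_ball (f := f) (c := x) (z := y) (R₁ := δ)
      (R₂ := 2 * C) hf.differentiableOn (fun w hw => ?_) (by rwa [mem_ball, dist_eq_norm])
    · rwa [dist_eq_norm, dist_eq_norm] at this
    · rw [mem_closedBall, dist_eq_norm]
      rw [mem_ball, dist_eq_norm] at hw
      refine hsub w ?_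
      have : ‖w‖ ≤ ‖w - x‖ + ‖x‖ := by simpa using norm_add_le (w - x) x
      linarith
  · refine (hsub y (by linarith)).trans ?_
    rw [div_mul_eq_mul_div, le_div_iff₀ hδ]
    push Not at h
    gcongr

theorem norm_fderiv_le_of_norm_le_ball {f : V → W} (hf : Differentiable ℂ f) {R δ C : ℝ}
    (hδ : 0 < δ) (hb : ∀ x, ‖x‖ < R + δ → ‖f x‖ ≤ C) {x : V} (hx : ‖x‖ ≤ R) :
    ‖fderiv ℂ f x‖ ≤ 2 * C / δ := by
  refine Complex.norm_fderiv_le_div_of_mapsTo_ball hf.differentiableOn (fun w hw => ?_) hδ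
  rw [mem_closedBall, dist_eq_norm]
  rw [mem_ball, dist_eq_norm] at hw
  have : ‖w‖ ≤ ‖w - x‖ + ‖x‖ := by simpa using norm_add_le (w - x) x
  exact (norm_sub_le _ _).trans (by linarith [hb w (by linarith), hb x (by linarith)])

/-- A Schwarz lemma of order two for the Taylor remainder, giving a quadratic estimate from a sup
bound alone. -/
theorem norm_sub_sub_fderiv_le_of_norm_le_ball {f : V → W} (hf : Differentiable ℂ f)
    {R δ C : ℝ} (hδ : 0 < δ) (hb : ∀ x, ‖x‖ < R + δ → ‖f x‖ ≤ C) {x y : V} (hx : ‖x‖ ≤ R)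
    (hy : ‖y - x‖ < δ) :
    ‖f y - f x - fderiv ℂ f x (y - x)‖ ≤ 4 * C / δ ^ 2 * ‖y - x‖ ^ 2 := by
  have hC : 0 ≤ C := (norm_nonneg _).trans (hb x (by linarith))
  have hD := norm_fderiv_le_of_norm_le_ball hf hδ hb hx
  set D := fderiv ℂ f x
  have key := Complex.dist_le_mul_div_pow_of_mapsTo_ball_of_isLittleO
    (f := fun w => f w - D (w - x)) (c := x) (z := y) (R₁ := δ) (R₂ := 4 * C) (n := 1)
    ?_ (fun w hw => ?_) ?_ (by rwa [mem_ball, dist_eq_norm])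
  · rw [dist_eq_norm, dist_eq_norm] at key
    simp only [sub_self, map_zero, sub_zero] at key
    rw [sub_right_comm]
    refine key.trans_eq ?_
    ring
  · exact (hf.sub (D.differentiable.comp (differentiable_id.sub_const x))).differentiableOn
  · rw [mem_closedBall, dist_eq_norm]
    rw [mem_ball, dist_eq_norm] at hw
    simp only [sub_self, map_zero, sub_zero]
    have h1 : ‖w‖ ≤ ‖w - x‖ + ‖x‖ := by simpa using norm_add_le (w - x) x
    have h2 : ‖D (w - x)‖ ≤ 2 * C := by
      refine (D.le_opNorm _).trans ?_
      calc ‖D‖ * ‖w - x‖ ≤ 2 * C / δ * δ := by gcongr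
        _ = 2 * C := by field_simp
    have h3 := norm_sub_le (f w - D (w - x)) (f x)
    have h4 := norm_sub_le (f w) (D (w - x))
    linarith [hb w (by linarith), hb x (by linarith)]
  · have h := (hf x).hasFDerivAt.isLittleO
    simp only [sub_self, map_zero, sub_zero, pow_one]
    refine (h.congr_left fun w => ?_).norm_right
    simp only [D]
    abel

theorem exists_solution_of_isPicardLindelof {V : Type*} [NormedAddCommGroup V] [NormedSpace ℝ V]
    [CompleteSpace V] {Y : ℝ → V → V} {h : ℝ} (hh : 0 ≤ h) {x : V} {a L K : ℝ≥0}
    (hY : IsPicardLindelof Y (⟨0, le_rfl, hh⟩ : Icc 0 h) x a 0 L K) :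
    ∃ u : ℝ → V, u 0 = x ∧
      ∀ s ∈ Icc 0 h, HasDerivWithinAt u (Y s (u s)) (Icc 0 h) s ∧ u s ∈ closedBall x a := by
  have hx : x ∈ closedBall x ((0 : ℝ≥0) : ℝ) := by simp
  obtain ⟨α, hα⟩ := ODE.FunSpace.exists_isFixedPt_next hY hx
  rw [ODE.FunSpace.isFixedPt_next_iff] at hα
  have hmem : ∀ s, α.compProj s ∈ closedBall x (a : ℝ) := fun s =>
    α.compProj_mem_closedBall hY.mul_max_le
  refine ⟨α.compProj, ?_, fun s hs => ⟨?_, hmem s⟩⟩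
  · have := hα ⟨0, le_rfl, hh⟩
    rw [ODE.picard_apply₀] at this
    exact (ODE.FunSpace.compProj_of_mem (⟨le_rfl, hh⟩ : (0 : ℝ) ∈ Icc 0 h)).trans this
  · refine (ODE.hasDerivWithinAt_picard_Icc (t₀ := (0 : ℝ)) ⟨le_rfl, hh⟩ hY.continuousOn_uncurry
      α.continuous_compProj.continuousOn (fun s _ => hmem s) x hs).congr_of_mem (fun t ht => ?_) hs
    rw [ODE.FunSpace.compProj_of_mem ht]
    exact hα ⟨t, ht⟩

theorem hasDerivWithinAt_Ici_of_Icc {V : Type*} [NormedAddCommGroup V] [NormedSpace ℝ V]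
    {u : ℝ → V} {u' : V} {h s : ℝ} (hs : s ∈ Ico 0 h) (hu : HasDerivWithinAt u u' (Icc 0 h) s) :
    HasDerivWithinAt u u' (Ici s) s :=
  hu.mono_of_mem_nhdsWithin (Icc_mem_nhdsGE_of_mem hs)

theorem gronwallBound_zero_left (K ε x : ℝ) :
    gronwallBound 0 K ε x = ε * gronwallBound 0 K 1 x := by
  by_cases hK : K = 0
  · simp [gronwallBound, hK]
  · simp [gronwallBound, hK]
    ring

/-- Solutions of the linear equation `w' = D w` on a short interval. -/
theorem exists_linear_solution [CompleteSpace V] {D : ℝ → V →L[ℂ] V} {h Λ : ℝ} (hh : 0 ≤ h)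
    (hΛ : 0 ≤ Λ) (hD : ContinuousOn D (Icc 0 h)) (hDΛ : ∀ s ∈ Icc 0 h, ‖D s‖ ≤ Λ)
    (hΛh : 2 * Λ * h ≤ 1) :
    ∃ U : ℝ → V →L[ℂ] V, U 0 = ContinuousLinearMap.id ℂ V ∧
      ∀ s ∈ Icc 0 h, HasDerivWithinAt U ((D s).comp (U s)) (Icc 0 h) s := by
  have hP : IsPicardLindelof (fun s (U : V →L[ℂ] V) => (D s).comp U)
      (⟨0, le_rfl, hh⟩ : Icc 0 h) (ContinuousLinearMap.id ℂ V) 1 0 (2 * Λ.toNNReal)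
      Λ.toNNReal := by
    refine ⟨fun s hs => ?_, fun U _ => ?_, fun s hs U hU => ?_, ?_⟩
    · refine LipschitzWith.lipschitzOnWith (LipschitzWith.of_dist_le_mul fun U U' => ?_)
      rw [dist_eq_norm, dist_eq_norm, ← ContinuousLinearMap.comp_sub, Real.coe_toNNReal _ hΛ]
      refine (ContinuousLinearMap.opNorm_comp_le _ _).trans ?_
      gcongr
      exact hDΛ s hs
    · exact hD.clm_comp continuousOn_const
    · have hU' : ‖U‖ ≤ 2 := by
        rw [mem_closedBall, dist_eq_norm] at hU
        have h1 := norm_add_le (U - ContinuousLinearMap.id ℂ V) (ContinuousLinearMap.id ℂ V)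
        rw [sub_add_cancel] at h1
        have h2 := ContinuousLinearMap.norm_id_le (𝕜 := ℂ) (E := V)
        simp only [NNReal.coe_one] at hU
        linarith
      refine (ContinuousLinearMap.opNorm_comp_le _ _).trans ?_
      push_cast
      rw [Real.coe_toNNReal _ hΛ, mul_comm]
      gcongr
      exact hDΛ s hs
    · push_cast
      rw [Real.coe_toNNReal _ hΛ, sub_zero, sub_self, max_eq_left hh]
      simpa using hΛh
  obtain ⟨U, hU0, hU⟩ := exists_solution_of_isPicardLindelof hh hP
  exact ⟨U, hU0, fun s hs => (hU s hs).1⟩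

/-- The flow of a bounded holomorphic vector field and its derivative, which solves the
linearised equation. -/
theorem exists_flow [CompleteSpace V] {Y : V → V} (hY : ContDiff ℂ 1 Y) {r C h : ℝ} (hr : 0 < r)
    (hh : 0 ≤ h) (hb : ∀ x, ‖x‖ < 4 * r → ‖Y x‖ ≤ C) (hC : 4 * C * h ≤ r) :
    ∃ Ψ : V → ℝ → V, ∀ x, ‖x‖ < r → Ψ x 0 = x ∧
      (∀ s ∈ Icc 0 h, HasDerivWithinAt (Ψ x) (Y (Ψ x s)) (Icc 0 h) s ∧ ‖Ψ x s‖ ≤ 2 * r) ∧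
      ∃ U : ℝ → V →L[ℂ] V, U 0 = ContinuousLinearMap.id ℂ V ∧
        (∀ s ∈ Icc 0 h,
          HasDerivWithinAt U ((fderiv ℂ Y (Ψ x s)).comp (U s)) (Icc 0 h) s) ∧
        HasFDerivAt (fun y => Ψ y h) (U h) x := by
  have hC0 : 0 ≤ C := (norm_nonneg _).trans (hb 0 (by simpa using hr))
  have hYd : Differentiable ℂ Y := hY.differentiable one_ne_zero
  have hb' : ∀ x, ‖x‖ < 3 * r + r → ‖Y x‖ ≤ C := fun x hx => hb x (by linarith)
  -- Cauchy bound for the derivative on the ball of radius `3r`. Since `Ch ≤ r/4`, solutions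
  -- starting in the ball of radius `r` stay within `2r`.
  set Λ : ℝ := 2 * C / r with hΛdef
  have hΛ : 0 ≤ Λ := by positivity
  have hΛh : 2 * Λ * h ≤ 1 := by
    rw [hΛdef, ← mul_div_assoc, div_mul_eq_mul_div, div_le_one hr]
    linarith
  have hlip : LipschitzOnWith Λ.toNNReal Y (closedBall 0 (3 * r)) := by
    refine LipschitzOnWith.of_dist_le_mul fun x hx y hy => ?_
    rw [dist_eq_norm, dist_eq_norm, Real.coe_toNNReal _ hΛ]
    exact norm_sub_le_of_norm_le_ball hYd hr hb' (mem_closedBall_zero_iff.1 hy)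
      (mem_closedBall_zero_iff.1 hx)
  have hex : ∀ x, ∃ u : ℝ → V, ‖x‖ < r → u 0 = x ∧ ∀ s ∈ Icc 0 h,
      HasDerivWithinAt u (Y (u s)) (Icc 0 h) s ∧ ‖u s‖ ≤ 2 * r := by
    intro x
    by_cases hx : ‖x‖ < r
    · have hsub : closedBall x r ⊆ closedBall 0 (2 * r) := by
        refine closedBall_subset_closedBall' ?_
        rw [dist_zero_right]
        linarith
      have hP : IsPicardLindelof (fun _ => Y) (⟨0, le_rfl, hh⟩ : Icc 0 h) x r.toNNReal 0
          C.toNNReal Λ.toNNReal := by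
        refine IsPicardLindelof.of_time_independent (fun y hy => ?_) (hlip.mono ?_) ?_
        · rw [Real.coe_toNNReal _ hr.le] at hy
          rw [Real.coe_toNNReal _ hC0]
          have := mem_closedBall_zero_iff.1 (hsub hy)
          exact hb y (by linarith)
        · rw [Real.coe_toNNReal _ hr.le]
          exact hsub.trans (closedBall_subset_closedBall (by linarith))
        · rw [Real.coe_toNNReal _ hr.le, Real.coe_toNNReal _ hC0, sub_zero, sub_self,
            max_eq_left hh, NNReal.coe_zero, sub_zero]
          nlinarith
      obtain ⟨u, hu0, hu⟩ := exists_solution_of_isPicardLindelof hh hP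
      refine ⟨u, fun _ => ⟨hu0, fun s hs => ⟨(hu s hs).1, ?_⟩⟩⟩
      have := (hu s hs).2
      rw [Real.coe_toNNReal _ hr.le] at this
      exact mem_closedBall_zero_iff.1 (hsub this)
    · exact ⟨fun _ => 0, fun hx' => absurd hx' hx⟩
  choose Ψ hΨ using hex
  refine ⟨Ψ, fun x hx => ⟨(hΨ x hx).1, (hΨ x hx).2, ?_⟩⟩
  have hcont : ∀ y, ‖y‖ < r → ContinuousOn (Ψ y) (Icc 0 h) := fun y hy s hs =>
    ((hΨ y hy).2 s hs).1.continuousWithinAt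
  have hmem : ∀ y, ‖y‖ < r → ∀ s ∈ Icc 0 h, ‖Ψ y s‖ ≤ 3 * r := fun y hy s hs =>
    ((hΨ y hy).2 s hs).2.trans (by linarith)
  have hD : ∀ s ∈ Icc 0 h, ‖fderiv ℂ Y (Ψ x s)‖ ≤ Λ := fun s hs =>
    norm_fderiv_le_of_norm_le_ball hYd hr hb' (hmem x hx s hs)
  obtain ⟨U, hU0, hU⟩ := exists_linear_solution (D := fun s => fderiv ℂ Y (Ψ x s)) hh hΛ
    ((hY.continuous_fderiv one_ne_zero).comp_continuousOn (hcont x hx)) hD hΛh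
  refine ⟨U, hU0, hU, ?_⟩
  have hIco : ∀ {s}, s ∈ Ico 0 h → s ∈ Icc 0 h := fun hs => Ico_subset_Icc_self hs
  have hh' : h ∈ Icc 0 h := ⟨hh, le_rfl⟩
  set e := Real.exp (Λ * h)
  have hdist : ∀ v, ‖x + v‖ < r → ∀ s ∈ Icc 0 h, ‖Ψ (x + v) s - Ψ x s‖ ≤ ‖v‖ * e := by
    intro v hv s hs
    have := dist_le_of_trajectories_ODE_of_mem (v := fun _ => Y)
      (s := fun _ => closedBall 0 (3 * r)) (K := Λ.toNNReal) (δ := ‖v‖) (fun _ _ => hlip)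
      (hcont _ hv) (fun t ht => hasDerivWithinAt_Ici_of_Icc ht ((hΨ _ hv).2 t (hIco ht)).1)
      (fun t ht => mem_closedBall_zero_iff.2 (hmem _ hv t (hIco ht)))
      (hcont _ hx) (fun t ht => hasDerivWithinAt_Ici_of_Icc ht ((hΨ _ hx).2 t (hIco ht)).1)
      (fun t ht => mem_closedBall_zero_iff.2 (hmem _ hx t (hIco ht)))
      (by rw [(hΨ _ hv).1, (hΨ _ hx).1, dist_eq_norm, add_sub_cancel_left]) s hs
    rw [dist_eq_norm, Real.coe_toNNReal _ hΛ, sub_zero] at this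
    refine this.trans ?_
    exact mul_le_mul_of_nonneg_left
      (Real.exp_le_exp.2 (mul_le_mul_of_nonneg_left hs.2 hΛ)) (norm_nonneg _)
  -- The difference of two nearby solutions solves the linearised equation with a defect quadratic
  -- in `v`, so Grönwall's inequality compares it with `U s v`.
  have hquad : ∀ v, ‖x + v‖ < r → ‖v‖ * e < r →
      ‖Ψ (x + v) h - Ψ x h - U h v‖ ≤
        4 * C / r ^ 2 * e ^ 2 * gronwallBound 0 Λ 1 h * ‖v‖ ^ 2 := by
    intro v hv hvr
    have hUv : ∀ s ∈ Icc 0 h,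
        HasDerivWithinAt (fun s => U s v) (fderiv ℂ Y (Ψ x s) (U s v)) (Icc 0 h) s := by
      intro s hs
      exact ((ContinuousLinearMap.apply ℂ V v).restrictScalars ℝ).hasFDerivAt
        |>.comp_hasDerivWithinAt s (hU s hs)
    have := dist_le_of_approx_trajectories_ODE_of_mem
      (v := fun s w => fderiv ℂ Y (Ψ x s) w) (s := fun _ => univ) (K := Λ.toNNReal)
      (f := fun s => Ψ (x + v) s - Ψ x s) (f' := fun s => Y (Ψ (x + v) s) - Y (Ψ x s))
      (g := fun s => U s v) (g' := fun s => fderiv ℂ Y (Ψ x s) (U s v)) (δ := 0)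
      (εf := 4 * C / r ^ 2 * (‖v‖ * e) ^ 2) (εg := 0) (a := 0) (b := h)
      (fun s hs => ?_) ((hcont _ hv).sub (hcont _ hx))
      (fun s hs => ?_) (fun s hs => ?_) (fun _ _ => mem_univ _)
      (fun s hs => (hUv s hs).continuousWithinAt)
      (fun s hs => hasDerivWithinAt_Ici_of_Icc hs (hUv s (hIco hs)))
      (fun s hs => by rw [dist_self]) (fun _ _ => mem_univ _) ?_ h hh'
    · rw [dist_eq_norm, Real.coe_toNNReal _ hΛ, sub_zero, add_zero,
        gronwallBound_zero_left] at this
      refine this.trans_eq ?_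
      ring
    · refine LipschitzWith.lipschitzOnWith ?_
      refine (fderiv ℂ Y (Ψ x s)).lipschitz.weaken ?_
      rw [← NNReal.coe_le_coe, Real.coe_toNNReal _ hΛ]
      exact hD s (hIco hs)
    · exact (hasDerivWithinAt_Ici_of_Icc hs ((hΨ _ hv).2 s (hIco hs)).1).sub
        (hasDerivWithinAt_Ici_of_Icc hs ((hΨ _ hx).2 s (hIco hs)).1)
    · rw [dist_eq_norm]
      have hd := hdist v hv s (hIco hs)
      refine (norm_sub_sub_fderiv_le_of_norm_le_ball hYd hr hb' (hmem x hx s (hIco hs))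
        (hd.trans_lt hvr)).trans ?_
      gcongr
    · rw [(hΨ _ hv).1, (hΨ _ hx).1, hU0]
      simp
  rw [hasFDerivAt_iff_isLittleO_nhds_zero]
  refine Asymptotics.IsBigO.trans_isLittleO (Asymptotics.IsBigO.of_bound
    (4 * C / r ^ 2 * e ^ 2 * gronwallBound 0 Λ 1 h) (g := fun v => ‖v‖ ^ 2) ?_)
    (Asymptotics.isLittleO_norm_pow_id one_lt_two)
  have h1 : ∀ᶠ v in 𝓝 (0 : V), ‖x + v‖ < r := by
    have : ContinuousAt (fun v => ‖x + v‖) (0 : V) := by fun_prop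
    exact this.eventually_lt_const (by simpa using hx)
  have h2 : ∀ᶠ v in 𝓝 (0 : V), ‖v‖ * e < r := by
    have : ContinuousAt (fun v : V => ‖v‖ * e) (0 : V) := by fun_prop
    exact this.eventually_lt_const (by simpa using hr)
  filter_upwards [h1, h2] with v hv1 hv2
  rw [norm_pow, norm_norm]
  exact hquad v hv1 hv2

end Flow

end

section

open Set Metric
open scoped NNReal Topology

/-! ### Hamiltonian flows are exact symplectic -/

section Symplectic

variable {E : Type*} [NormedAddCommGroup E] [NormedSpace ℂ E]

/-- The Lagrangian density `½ B(x, X(x)) - i H(x)` of the Hamiltonian vector field `X`. -/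
noncomputable def actionDensity (B : E →L[ℂ] E →L[ℂ] ℂ) (X : E → E) (H : E → ℂ) (x : E) : ℂ :=
  1 / 2 * B x (X x) - Complex.I * H x

variable {B : E →L[ℂ] E →L[ℂ] ℂ} {X : E → E} {H : E → ℂ}

theorem contDiff_actionDensity (hX : ContDiff ℂ 1 X) (hH : ContDiff ℂ 1 H) :
    ContDiff ℂ 1 (actionDensity B X H) :=
  (contDiff_const.mul ((B.contDiff.comp contDiff_id).clm_apply hX)).sub (contDiff_const.mul hH)

theorem fderiv_actionDensity (hX : ContDiff ℂ 1 X) (hH : ContDiff ℂ 1 H)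
    (hXH : ∀ x v, fderiv ℂ H x v = -Complex.I * B v (X x)) (x v : E) :
    fderiv ℂ (actionDensity B X H) x v =
      1 / 2 * B x (fderiv ℂ X x v) - 1 / 2 * B v (X x) := by
  have h1 := (hX.differentiable one_ne_zero x).hasFDerivAt
  have h2 := (hH.differentiable one_ne_zero x).hasFDerivAt
  have h3 := (B.hasFDerivAt_of_bilinear (hasFDerivAt_id x) h1).const_mul (1 / 2 : ℂ)
  have h4 := h3.sub (h2.const_mul Complex.I)
  have h5 : fderiv ℂ (actionDensity B X H) x = _ := h4.fderiv
  rw [h5]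
  simp only [sub_apply, smul_apply, id, add_apply, ContinuousLinearMap.compL_apply,
    ContinuousLinearMap.comp_apply, ContinuousLinearMap.precompR_apply,
    ContinuousLinearMap.precompL_apply, smul_eq_mul, hXH, ContinuousLinearMap.id_apply]
  linear_combination (B v (X x)) * Complex.I_mul_I

/-- The system is augmented by one scalar variable that integrates `actionDensity`; its final value,
started from `0`, is the generating function `S`. Exactness follows by differentiating along the
linearised augmented flow. -/
theorem exists_hamiltonian_flow [CompleteSpace E] (hX : ContDiff ℂ 1 X) (hH : ContDiff ℂ 1 H)
    (hB : ∀ x y, B x y = -B y x) (hXH : ∀ x v, fderiv ℂ H x v = -Complex.I * B v (X x))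
    {r C h : ℝ} (hr : 0 < r) (hh : 0 ≤ h) (hXb : ∀ x, ‖x‖ < 4 * r → ‖X x‖ ≤ C)
    (hAb : ∀ x, ‖x‖ < 4 * r → ‖actionDensity B X H x‖ ≤ C) (hC : 4 * C * h ≤ r) :
    ∃ (Φ : E → E) (S : E → ℂ), ∀ x, ‖x‖ < r →
      DifferentiableAt ℂ Φ x ∧ DifferentiableAt ℂ S x ∧
      (∀ v, fderiv ℂ S x v = 1 / 2 * B (Φ x) (fderiv ℂ Φ x v) - 1 / 2 * B x v) ∧
      ‖Φ x - x‖ ≤ C * h ∧ ‖S x‖ ≤ C * h ∧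
      ∃ u : ℝ → E, u 0 = x ∧ u h = Φ x ∧
        ∀ s ∈ Icc 0 h, HasDerivWithinAt u (X (u s)) (Icc 0 h) s ∧ ‖u s‖ ≤ 2 * r := by
  set A := actionDensity B X H
  have hA : ContDiff ℂ 1 A := contDiff_actionDensity hX hH
  have hY : ContDiff ℂ 1 fun p : E × ℂ => (X p.1, A p.1) :=
    (hX.comp contDiff_fst).prodMk (hA.comp contDiff_fst)
  have hYb : ∀ p : E × ℂ, ‖p‖ < 4 * r → ‖(X p.1, A p.1)‖ ≤ C := fun p hp =>
    norm_prod_le_iff.2 ⟨hXb _ ((norm_fst_le p).trans_lt hp), hAb _ ((norm_fst_le p).trans_lt hp)⟩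
  obtain ⟨Ψ, hΨ⟩ := exists_flow hY hr hh hYb hC
  have hh' : h ∈ Icc 0 h := ⟨hh, le_rfl⟩
  refine ⟨fun x => (Ψ (x, 0) h).1, fun x => (Ψ (x, 0) h).2, fun x hx => ?_⟩
  obtain ⟨hΨ0, hΨs, U, hU0, hU, hUh⟩ := hΨ (x, 0) (by simpa using hx)
  have hd : HasFDerivAt (fun x => Ψ (x, 0) h) ((U h).comp (ContinuousLinearMap.inl ℂ E ℂ)) x :=
    HasFDerivAt.comp (f := fun x : E => ((x, 0) : E × ℂ)) x hUh
      (ContinuousLinearMap.inl ℂ E ℂ).hasFDerivAt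
  have hd1 := hd.fst
  have hd2 := hd.snd
  have hbound : ‖Ψ (x, 0) h - (x, 0)‖ ≤ C * h := by
    have := norm_image_sub_le_of_norm_deriv_le_segment' (fun s hs => (hΨs s hs).1) (C := C)
      (fun s hs => hYb _ ?_) h hh'
    · rwa [hΨ0, sub_zero] at this
    · have := (hΨs s (Ico_subset_Icc_self hs)).2
      linarith
  have hu : ∀ s ∈ Icc 0 h, HasDerivWithinAt (fun s => (Ψ (x, 0) s).1) (X (Ψ (x, 0) s).1)
      (Icc 0 h) s := fun s hs => (hΨs s hs).1.fst
  refine ⟨hd1.differentiableAt, hd2.differentiableAt, fun v => ?_,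
    (norm_fst_le _).trans hbound, ?_, fun s => (Ψ (x, 0) s).1, congrArg Prod.fst hΨ0, rfl,
    fun s hs => ⟨hu s hs, (norm_fst_le _).trans (hΨs s hs).2⟩⟩
  · have hUv : ∀ s ∈ Icc 0 h, HasDerivWithinAt (fun s => U s (v, 0))
        (fderiv ℂ X (Ψ (x, 0) s).1 (U s (v, 0)).1, fderiv ℂ A (Ψ (x, 0) s).1 (U s (v, 0)).1)
        (Icc 0 h) s := by
      intro s hs
      have h1 := ((ContinuousLinearMap.apply ℂ (E × ℂ) ((v, 0) : E × ℂ)).restrictScalars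
        ℝ).hasFDerivAt.comp_hasDerivWithinAt s (hU s hs)
      refine h1.congr_deriv ?_
      have hY' : HasFDerivAt (fun p : E × ℂ => (X p.1, A p.1)) _ (Ψ (x, 0) s) :=
        (((hX.differentiable one_ne_zero _).hasFDerivAt).comp _ hasFDerivAt_fst).prodMk
          (((hA.differentiable one_ne_zero _).hasFDerivAt).comp _ hasFDerivAt_fst)
      simp [hY'.fderiv]
    -- Along a tangent solution, the one-form `½B(u, ·)` minus the variation of the action is
    -- constant: the formula for the derivative of `actionDensity` and skew-symmetry of `B` cancel
    -- all terms.
    have hconst := constant_of_has_deriv_right_zero (a := 0) (b := h)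
      (f := fun s => 1 / 2 * B (Ψ (x, 0) s).1 (U s (v, 0)).1 - (U s (v, 0)).2) ?_ ?_ h hh'
    · simp only [hΨ0, hU0, ContinuousLinearMap.id_apply, sub_zero] at hconst
      rw [hd1.fderiv, hd2.fderiv, ← hconst]
      simp
    · intro s hs
      have h1 := (hu s hs).continuousWithinAt
      have h2 := (hUv s hs).continuousWithinAt.fst
      have h3 := (hUv s hs).continuousWithinAt.snd
      refine ContinuousWithinAt.sub (continuousWithinAt_const.mul ?_) h3
      exact (B.continuous.continuousAt.comp_continuousWithinAt h1).clm_apply h2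
    · intro s hs
      have hs' := Ico_subset_Icc_self hs
      refine hasDerivWithinAt_Ici_of_Icc hs ?_
      have h1 := (ContinuousLinearMap.bilinearRestrictScalars ℝ B).hasDerivWithinAt_of_bilinear
        (hu s hs') (hUv s hs').fst
      refine ((h1.const_mul (1 / 2 : ℂ)).sub (hUv s hs').snd).congr_deriv ?_
      rw [fderiv_actionDensity hX hH hXH]
      simp only [ContinuousLinearMap.bilinearRestrictScalars_apply_apply]
      rw [hB (U s (v, 0)).1]
      ring
  · have := (norm_snd_le _).trans hbound
    simpa using this

end Symplectic

end

section

open scoped Topology ComplexConjugate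

/-! ### Bounded multilinear maps on `ℓ¹` -/

section EllOneMultilinear

variable {ι : Type*}

theorem EllOne.hasSum_norm (z : lp (fun _ : ι => ℂ) 1) : HasSum (fun j => ‖z j‖) ‖z‖ := by
  simpa using lp.hasSum_norm (p := 1) (by norm_num) z

theorem EllOne.norm_apply_le (z : lp (fun _ : ι => ℂ) 1) (j : ι) : ‖z j‖ ≤ ‖z‖ :=
  lp.norm_apply_le_norm one_ne_zero z j

theorem hasSum_prod_pi_fin (l : ℕ) (a : Fin l → ι → ℝ) (A : Fin l → ℝ)
    (ha : ∀ i j, 0 ≤ a i j) (hA : ∀ i, HasSum (a i) (A i)) :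
    HasSum (fun j : Fin l → ι => ∏ i, a i (j i)) (∏ i, A i) := by
  induction l with
  | zero =>
    simp
  | succ l ih =>
    have h1 := hA 0
    have h2 := ih (fun i => a i.succ) (fun i => A i.succ) (fun i => ha i.succ) fun i => hA i.succ
    have h0 : Summable fun p : ι × (Fin l → ι) => a 0 p.1 * ∏ i, a (Fin.succ i) (p.2 i) :=
      Summable.mul_of_nonneg (f := a 0) (g := fun j : Fin l → ι => ∏ i, a (Fin.succ i) (j i))
        h1.summable h2.summable (fun j => ha 0 j) (fun j => Finset.prod_nonneg fun i _ => ha _ _)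
    have h3 := h1.mul h2 h0
    rw [← (Fin.consEquiv fun _ : Fin (l + 1) => ι).hasSum_iff, Fin.prod_univ_succ]
    refine h3.congr_fun fun p => ?_
    simp [Fin.prod_univ_succ]

variable {W : Type*} [NormedAddCommGroup W] [NormedSpace ℂ W] {l : ℕ}
  {c : (Fin l → ι) → W} {C : ℝ}

theorem norm_prod_smul_le (hc : ∀ j, ‖c j‖ ≤ C) (z : Fin l → lp (fun _ : ι => ℂ) 1)
    (j : Fin l → ι) : ‖(∏ i, z i (j i)) • c j‖ ≤ C * ∏ i, ‖z i (j i)‖ := by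
  rw [norm_smul, norm_prod, mul_comm]
  gcongr
  exact hc j

theorem hasSum_mul_prod_norm (C : ℝ) (z : Fin l → lp (fun _ : ι => ℂ) 1) :
    HasSum (fun j : Fin l → ι => C * ∏ i, ‖z i (j i)‖) (C * ∏ i, ‖z i‖) :=
  (hasSum_prod_pi_fin l (fun i j => ‖z i j‖) (fun i => ‖z i‖) (fun _ _ => norm_nonneg _)
    fun i => EllOne.hasSum_norm (z i)).mul_left C

variable [CompleteSpace W]

theorem summable_prod_smul (hc : ∀ j, ‖c j‖ ≤ C) (z : Fin l → lp (fun _ : ι => ℂ) 1) :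
    Summable fun j : Fin l → ι => (∏ i, z i (j i)) • c j :=
  Summable.of_norm_bounded (hasSum_mul_prod_norm C z).summable (norm_prod_smul_le hc z)

/-- The continuous multilinear map on `ℓ¹` with bounded coefficients `c`. -/
noncomputable def ellOneMultilinear (c : (Fin l → ι) → W) (C : ℝ) (hc : ∀ j, ‖c j‖ ≤ C) :
    ContinuousMultilinearMap ℂ (fun _ : Fin l => lp (fun _ : ι => ℂ) 1) W :=
  MultilinearMap.mkContinuous
    { toFun := fun z => ∑' j : Fin l → ι, (∏ i, z i (j i)) • c j
      map_update_add' := by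
        intro _ z i x y
        rw [← (summable_prod_smul hc _).tsum_add (summable_prod_smul hc _)]
        refine tsum_congr fun j => ?_
        have h := ((MultilinearMap.mkPiAlgebra ℂ (Fin l) ℂ).compLinearMap fun i =>
          (lp.evalCLM ℂ (fun _ : ι => ℂ) 1 (j i)).toLinearMap).map_update_add z i x y
        rw [← add_smul]
        congr 1
      map_update_smul' := by
        intro _ z i a x
        rw [← (summable_prod_smul hc _).tsum_const_smul]
        refine tsum_congr fun j => ?_
        have h := ((MultilinearMap.mkPiAlgebra ℂ (Fin l) ℂ).compLinearMap fun i =>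
          (lp.evalCLM ℂ (fun _ : ι => ℂ) 1 (j i)).toLinearMap).map_update_smul z i a x
        rw [smul_smul]
        congr 1 }
    C fun z => tsum_of_norm_bounded (hasSum_mul_prod_norm C z) (norm_prod_smul_le hc z)

theorem ellOneMultilinear_apply (hc : ∀ j, ‖c j‖ ≤ C) (z : Fin l → lp (fun _ : ι => ℂ) 1) :
    ellOneMultilinear c C hc z = ∑' j : Fin l → ι, (∏ i, z i (j i)) • c j := rfl

theorem norm_ellOneMultilinear_le (hc : ∀ j, ‖c j‖ ≤ C) (z : Fin l → lp (fun _ : ι => ℂ) 1) :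
    ‖ellOneMultilinear c C hc z‖ ≤ C * ∏ i, ‖z i‖ :=
  tsum_of_norm_bounded (hasSum_mul_prod_norm C z) (norm_prod_smul_le hc z)

end EllOneMultilinear

theorem ContinuousMultilinearMap.hasFDerivAt_diagonal {E W : Type*} [NormedAddCommGroup E]
    [NormedSpace ℂ E] [NormedAddCommGroup W] [NormedSpace ℂ W] {l : ℕ}
    (f : ContinuousMultilinearMap ℂ (fun _ : Fin l => E) W) (z : E) :
    HasFDerivAt (fun z => f fun _ => z)
      ((f.linearDeriv fun _ => z).comp
        (ContinuousLinearMap.pi fun _ => ContinuousLinearMap.id ℂ E)) z :=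
  HasFDerivAt.comp z (f.hasFDerivAt fun _ => z)
    (ContinuousLinearMap.pi fun _ : Fin l => ContinuousLinearMap.id ℂ E).hasFDerivAt

theorem ContinuousMultilinearMap.contDiff_diagonal {E W : Type*} [NormedAddCommGroup E]
    [NormedSpace ℂ E] [NormedAddCommGroup W] [NormedSpace ℂ W] {l : ℕ}
    (f : ContinuousMultilinearMap ℂ (fun _ : Fin l => E) W) :
    ContDiff ℂ 1 (fun z => f fun _ => z) :=
  f.contDiff.comp (contDiff_pi.2 fun _ => contDiff_id)

/-! ### Zero momentum, and the Hamiltonian vector field as a polynomial map of `ℓ¹` -/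

namespace Mode

variable {d : ℕ} {N : Set (Fin d → ℤ)}

theorem bar_bar (j : Mode N) : j.bar.bar = j := by
  simp [bar]

/-- The involution `j ↦ j̄`. -/
def barEquiv : Mode N ≃ Mode N := ⟨bar, bar, bar_bar, bar_bar⟩

theorem momentum_insertNth {l : ℕ} (i : Fin (l + 1)) (j : Mode N) (k : Fin l → Mode N) :
    momentum (i.insertNth j k : Fin (l + 1) → Mode N) =
      (j.2 : ℤ) • (j.1 : Fin d → ℤ) + momentum k := by
  simp [momentum, Fin.sum_univ_succAbove _ i]

theorem eq_of_momentum_insertNth {l : ℕ} (i : Fin (l + 1)) {j j' : Mode N} {k : Fin l → Mode N}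
    (hj : momentum (i.insertNth j k : Fin (l + 1) → Mode N) = 0)
    (hj' : momentum (i.insertNth j' k : Fin (l + 1) → Mode N) = 0) (h : j.2 = j'.2) : j = j' := by
  rw [momentum_insertNth] at hj hj'
  have h1 := add_right_cancel (hj.trans hj'.symm)
  rw [h] at h1
  refine Prod.ext (Subtype.ext ?_) h
  rcases Int.units_eq_one_or j'.2 with h2 | h2
  · simpa [h2] using h1
  · simpa [h2] using h1

end Mode

namespace PolyHam

variable {d : ℕ} {N : Set (Fin d → ℤ)} {k : ℕ} (P : PolyHam N k)

theorem coeff_eq_zero {l : ℕ} (hl : ¬(2 ≤ l ∧ l ≤ k)) (j : Fin l → Mode N) : P.coeff l j = 0 := by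
  by_contra h
  exact hl (P.degree l j h)

theorem norm_nonneg : 0 ≤ P.norm :=
  Finset.sum_nonneg fun _ _ => Real.iSup_nonneg fun _ => _root_.norm_nonneg _

theorem norm_coeff_le (l : ℕ) (j : Fin l → Mode N) : ‖P.coeff l j‖ ≤ P.norm := by
  by_cases hl : 2 ≤ l ∧ l ≤ k
  · obtain ⟨C, hC⟩ := P.bounded l
    have hbdd : BddAbove (Set.range fun j : Fin l → Mode N => ‖P.coeff l j‖) :=
      ⟨C, by rintro _ ⟨j, rfl⟩; exact hC j⟩
    exact (le_ciSup hbdd j).trans (Finset.single_le_sum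
      (f := fun l => ⨆ j : Fin l → Mode N, ‖P.coeff l j‖)
      (fun _ _ => Real.iSup_nonneg fun _ => _root_.norm_nonneg _) (Finset.mem_Icc.2 hl))
  · rw [P.coeff_eq_zero hl, norm_zero]
    exact P.norm_nonneg

/-- The coefficients of the component of the Hamiltonian vector field which comes from
differentiating the `i`-th factor of the monomials of degree `l + 1`. -/
def gradCoeff (l : ℕ) (i : Fin (l + 1)) (q : Fin l → Mode N) (j : Mode N) : ℂ :=
  -Complex.I * ((j.2 : ℤ) : ℂ) * P.coeff (l + 1) (i.insertNth j.bar q)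

theorem norm_unit (δ : ℤˣ) : ‖((δ : ℤ) : ℂ)‖ = 1 := by
  rcases Int.units_eq_one_or δ with h | h <;> simp [h]

theorem norm_gradCoeff_le (l : ℕ) (i : Fin (l + 1)) (q : Fin l → Mode N) (j : Mode N) :
    ‖P.gradCoeff l i q j‖ ≤ P.norm := by
  rw [gradCoeff, norm_mul, norm_mul, norm_neg, Complex.norm_I, norm_unit, one_mul, one_mul]
  exact P.norm_coeff_le _ _

/-- Once the other indices are fixed, zero momentum determines the remaining lattice point from its
sign. -/
theorem injOn_support_gradCoeff (l : ℕ) (i : Fin (l + 1)) (q : Fin l → Mode N) :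
    Set.InjOn Prod.snd (Function.support (P.gradCoeff l i q)) := by
  intro j hj j' hj' h
  have h1 := P.zero_momentum _ _ (right_ne_zero_of_mul hj)
  have h2 := P.zero_momentum _ _ (right_ne_zero_of_mul hj')
  have h3 := Mode.eq_of_momentum_insertNth i h1 h2 (by simp only [Mode.bar, h])
  rw [← Mode.bar_bar j, h3, Mode.bar_bar]

theorem finite_support_gradCoeff (l : ℕ) (i : Fin (l + 1)) (q : Fin l → Mode N) :
    (Function.support (P.gradCoeff l i q)).Finite :=
  Set.Finite.of_finite_image (Set.toFinite _) (P.injOn_support_gradCoeff l i q)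

/-- The coefficients `gradCoeff` as a point of `ℓ¹`. -/
def gradPoint (l : ℕ) (i : Fin (l + 1)) (q : Fin l → Mode N) : EllOne N :=
  ⟨P.gradCoeff l i q, (memℓp_zero (P.finite_support_gradCoeff l i q)).of_exponent_ge zero_le⟩

/-- At most two entries are nonzero, one for each sign. This is where zero momentum makes the vector
field map `ℓ¹` to itself although the coefficients are merely bounded. -/
theorem norm_gradPoint_le (l : ℕ) (i : Fin (l + 1)) (q : Fin l → Mode N) :
    ‖P.gradPoint l i q‖ ≤ 2 * P.norm := by
  set s := (P.finite_support_gradCoeff l i q).toFinset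
  have h1 : HasSum (fun j => ‖P.gradPoint l i q j‖) (∑ j ∈ s, ‖P.gradPoint l i q j‖) := by
    refine hasSum_sum_of_ne_finset_zero fun j hj => ?_
    have : P.gradCoeff l i q j = 0 := by simpa [s] using hj
    simpa [gradPoint] using this
  rw [(EllOne.hasSum_norm _).unique h1]
  have hcard : s.card ≤ 2 := by
    have := Finset.card_le_card_of_injOn (s := s) (t := Finset.univ) Prod.snd
      (fun _ _ => Finset.mem_coe.2 (Finset.mem_univ _))
      (by simpa [s] using P.injOn_support_gradCoeff l i q)
    simpa using this
  calc ∑ j ∈ s, ‖P.gradPoint l i q j‖ ≤ s.card • P.norm :=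
        Finset.sum_le_card_nsmul _ _ _ fun j _ => P.norm_gradCoeff_le l i q j
    _ ≤ 2 * P.norm := by
        rw [nsmul_eq_mul]
        have := P.norm_nonneg
        gcongr
        exact_mod_cast hcard

/-- The homogeneous part of degree `l`, as a multilinear map. -/
noncomputable def homogeneous (l : ℕ) : ContinuousMultilinearMap ℂ (fun _ : Fin l => EllOne N) ℂ :=
  ellOneMultilinear (P.coeff l) P.norm (P.norm_coeff_le l)

/-- The part of the Hamiltonian vector field with coefficients `gradCoeff`. -/
noncomputable def gradMultilinear (l : ℕ) (i : Fin (l + 1)) :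
    ContinuousMultilinearMap ℂ (fun _ : Fin l => EllOne N) (EllOne N) :=
  ellOneMultilinear (P.gradPoint l i) (2 * P.norm) (P.norm_gradPoint_le l i)

theorem eval_eq (z : EllOne N) :
    P.eval z = ∑ l ∈ Finset.range k, P.homogeneous (l + 1) fun _ => z := by
  have h1 : ∀ l, (∑' j : Fin l → Mode N, P.coeff l j * ∏ i, z (j i)) =
      P.homogeneous l fun _ => z := by
    intro l
    rw [homogeneous, ellOneMultilinear_apply]
    exact tsum_congr fun j => by rw [smul_eq_mul, mul_comm]
  simp only [eval, h1]
  have h2 := Finset.sum_Ico_eq_sum_range (fun l => P.homogeneous l fun _ => z) 1 (k + 1)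
  simp only [Nat.add_sub_cancel] at h2
  refine Eq.trans ?_ (h2.trans (Finset.sum_congr rfl fun l _ =>
    congrArg (fun n => P.homogeneous n fun _ => z) (add_comm 1 l)))
  refine Finset.sum_subset (fun l hl => ?_) fun l hl hl' => ?_
  · rw [Finset.mem_Icc] at hl
    rw [Finset.mem_Ico]
    omega
  · rw [Finset.mem_Ico] at hl
    rw [Finset.mem_Icc] at hl'
    rw [homogeneous, ellOneMultilinear_apply]
    simp [P.coeff_eq_zero hl']

theorem contDiff_eval : ContDiff ℂ 1 P.eval := by
  rw [funext P.eval_eq]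
  exact ContDiff.sum fun l _ => (P.homogeneous (l + 1)).contDiff_diagonal

theorem fderiv_eval_apply (z v : EllOne N) : fderiv ℂ P.eval z v =
    ∑ l ∈ Finset.range k, ∑ i : Fin (l + 1),
      P.homogeneous (l + 1) (Function.update (fun _ => z) i v) := by
  have h := HasFDerivAt.fun_sum (u := Finset.range k) fun l _ =>
    (P.homogeneous (l + 1)).hasFDerivAt_diagonal z
  rw [funext P.eval_eq, h.fderiv]
  simp [ContinuousMultilinearMap.linearDeriv_apply]

open Classical in
theorem homogeneous_update_single (l : ℕ) (z : EllOne N) (i : Fin (l + 1)) (j : Mode N) :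
    P.homogeneous (l + 1) (Function.update (fun _ => z) i (lp.single 1 j (1 : ℂ))) =
      ∑' q : Fin l → Mode N, (∏ p, z (q p)) * P.coeff (l + 1) (i.insertNth j q) := by
  rw [homogeneous, ellOneMultilinear_apply,
    ← (Fin.insertNth_right_injective (α := fun _ => Mode N) (p := i) j).tsum_eq]
  · refine tsum_congr fun q => ?_
    rw [Fin.prod_univ_succAbove _ i]
    simp
  · intro q hq
    refine ⟨i.removeNth q, ?_⟩
    have h1 : q i = j := by
      by_contra hne
      refine hq ?_
      have : ∏ p, (Function.update (fun _ : Fin (l + 1) => z) i (lp.single 1 j (1 : ℂ)) p) (q p)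
          = 0 := by
        refine Finset.prod_eq_zero (Finset.mem_univ i) ?_
        simp [hne]
      simp [this]
    rw [← h1, Fin.insertNth_self_removeNth]

/-- The Hamiltonian vector field as a map of `ℓ¹`. -/
noncomputable def field (z : EllOne N) : EllOne N :=
  ∑ l ∈ Finset.range k, ∑ i : Fin (l + 1), P.gradMultilinear l i fun _ => z

theorem contDiff_field : ContDiff ℂ 1 P.field :=
  ContDiff.sum fun l _ => ContDiff.sum fun i _ => (P.gradMultilinear l i).contDiff_diagonal

theorem field_apply (z : EllOne N) (j : Mode N) : P.field z j =
    ∑ l ∈ Finset.range k, ∑ i : Fin (l + 1),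
      ∑' q : Fin l → Mode N, (∏ p, z (q p)) * P.gradCoeff l i q j := by
  change lp.evalCLM ℂ (fun _ : Mode N => ℂ) 1 j (P.field z) = _
  rw [field, map_sum]
  refine Finset.sum_congr rfl fun l _ => ?_
  rw [map_sum]
  refine Finset.sum_congr rfl fun i _ => ?_
  rw [gradMultilinear, ellOneMultilinear_apply, ContinuousLinearMap.map_tsum _
    (summable_prod_smul (P.norm_gradPoint_le l i) _)]
  rfl

open Classical in
theorem field_apply_eq_fderiv (z : EllOne N) (j : Mode N) : P.field z j =
    -Complex.I * ((j.2 : ℤ) : ℂ) * fderiv ℂ P.eval z (lp.single 1 j.bar (1 : ℂ)) := by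
  rw [field_apply, fderiv_eval_apply, Finset.mul_sum]
  refine Finset.sum_congr rfl fun l _ => ?_
  rw [Finset.mul_sum]
  refine Finset.sum_congr rfl fun i _ => ?_
  rw [homogeneous_update_single, ← tsum_mul_left]
  refine tsum_congr fun q => ?_
  rw [gradCoeff]
  ring

/-- Passes from the coordinatewise definition by directional derivatives to a `C¹` map of `ℓ¹`, to
which the theory of flows applies. -/
theorem vectorField_eq_field (z : EllOne N) (j : Mode N) : P.vectorField z j = P.field z j := by
  rw [field_apply_eq_fderiv, vectorField, partialDeriv,
    (P.contDiff_eval.differentiable one_ne_zero z).lineDeriv_eq_fderiv]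

theorem norm_eval_le {ρ : ℝ} (hρ : 1 ≤ ρ) {z : EllOne N} (hz : ‖z‖ ≤ ρ) :
    ‖P.eval z‖ ≤ k * (P.norm * ρ ^ k) := by
  rw [eval_eq]
  refine (norm_sum_le_of_le _ fun l hl => ?_).trans_eq
    (by rw [Finset.sum_const, Finset.card_range, nsmul_eq_mul])
  refine (norm_ellOneMultilinear_le (P.norm_coeff_le (l + 1)) _).trans ?_
  have := P.norm_nonneg
  have hl' : l + 1 ≤ k := Finset.mem_range.1 hl
  simp only [Finset.prod_const, Finset.card_univ, Fintype.card_fin]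
  gcongr
  exact (pow_le_pow_left₀ (_root_.norm_nonneg _) hz _).trans (pow_le_pow_right₀ hρ hl')

theorem norm_field_le {ρ : ℝ} (hρ : 1 ≤ ρ) {z : EllOne N} (hz : ‖z‖ ≤ ρ) :
    ‖P.field z‖ ≤ k * (k * (2 * P.norm * ρ ^ k)) := by
  have hP := P.norm_nonneg
  refine (norm_sum_le_of_le _ fun l hl => ?_).trans_eq
    (by rw [Finset.sum_const, Finset.card_range, nsmul_eq_mul])
  have hl' : l + 1 ≤ k := Finset.mem_range.1 hl
  refine (norm_sum_le_of_le _ (f := fun i : Fin (l + 1) => P.gradMultilinear l i fun _ => z)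
    (n := fun _ => 2 * P.norm * ρ ^ k) fun i _ => ?_).trans ?_
  · refine (norm_ellOneMultilinear_le (P.norm_gradPoint_le l i) _).trans ?_
    simp only [Finset.prod_const, Finset.card_univ, Fintype.card_fin]
    gcongr
    exact (pow_le_pow_left₀ (_root_.norm_nonneg _) hz _).trans
      (pow_le_pow_right₀ hρ (by omega))
  · rw [Finset.sum_const, Finset.card_univ, Fintype.card_fin, nsmul_eq_mul]
    gcongr

end PolyHam

end

/-! ### Uniqueness of flows, symplectic and real structure, linear flow -/

section

open scoped Topology ComplexConjugate
open Set Metric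

/-- Both curves have compact range, so they stay in a ball where `X` is Lipschitz by Cauchy's
estimate. `IsFlow` only provides some solution; uniqueness identifies it with the constructed flow.
-/
theorem eqOn_of_integral_curves {V : Type*} [NormedAddCommGroup V] [NormedSpace ℂ V] {X : V → V}
    (hX : Differentiable ℂ X) (hb : ∀ ρ : ℝ, ∃ C : ℝ, ∀ x, ‖x‖ ≤ ρ → ‖X x‖ ≤ C) {h : ℝ}
    {u w : ℝ → V} (hu : ∀ s ∈ Icc 0 h, HasDerivWithinAt u (X (u s)) (Icc 0 h) s)
    (hw : ∀ s ∈ Icc 0 h, HasDerivWithinAt w (X (w s)) (Icc 0 h) s) (h0 : u 0 = w 0) :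
    EqOn u w (Icc 0 h) := by
  have huc : ContinuousOn u (Icc 0 h) := fun s hs => (hu s hs).continuousWithinAt
  have hwc : ContinuousOn w (Icc 0 h) := fun s hs => (hw s hs).continuousWithinAt
  obtain ⟨Cu, hCu⟩ := isCompact_Icc.exists_bound_of_continuousOn huc
  obtain ⟨Cw, hCw⟩ := isCompact_Icc.exists_bound_of_continuousOn hwc
  set ρ := max Cu Cw
  obtain ⟨C, hC⟩ := hb (ρ + 1)
  have hlip : LipschitzOnWith (2 * C).toNNReal X (closedBall 0 ρ) := by
    refine LipschitzOnWith.of_dist_le_mul fun x hx y hy => ?_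
    rw [dist_eq_norm, dist_eq_norm]
    refine (norm_sub_le_of_norm_le_ball hX one_pos (fun z hz => hC z hz.le)
      (mem_closedBall_zero_iff.1 hy) (mem_closedBall_zero_iff.1 hx)).trans ?_
    rw [div_one]
    gcongr
    exact Real.le_coe_toNNReal _
  have hIco : ∀ {s}, s ∈ Ico 0 h → s ∈ Icc 0 h := fun hs => Ico_subset_Icc_self hs
  exact ODE_solution_unique_of_mem_Icc_right (v := fun _ => X) (s := fun _ => closedBall 0 ρ)
    (fun _ _ => hlip) huc
    (fun s hs => hasDerivWithinAt_Ici_of_Icc hs (hu s (hIco hs)))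
    (fun s hs => mem_closedBall_zero_iff.2 ((hCu s (hIco hs)).trans (le_max_left _ _)))
    hwc (fun s hs => hasDerivWithinAt_Ici_of_Icc hs (hw s (hIco hs)))
    (fun s hs => mem_closedBall_zero_iff.2 ((hCw s (hIco hs)).trans (le_max_right _ _))) h0

variable {d : ℕ} {N : Set (Fin d → ℤ)}

/-! ### The symplectic form of `ℓ¹` -/

theorem norm_symplectic_term_le (x y : EllOne N) (j : Mode N) :
    ‖((j.2 : ℤ) : ℂ) * x j * y j.bar‖ ≤ ‖x j‖ * ‖y‖ := by
  rw [norm_mul, norm_mul, PolyHam.norm_unit, one_mul]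
  gcongr
  exact EllOne.norm_apply_le y _

theorem summable_symplectic (x y : EllOne N) :
    Summable fun j : Mode N => ((j.2 : ℤ) : ℂ) * x j * y j.bar :=
  Summable.of_norm_bounded ((EllOne.hasSum_norm x).mul_right ‖y‖).summable
    (norm_symplectic_term_le x y)

/-- The symplectic form `∑_j δ_j x_j y_{j̄}`. -/
noncomputable def symplecticForm (N : Set (Fin d → ℤ)) : EllOne N →L[ℂ] EllOne N →L[ℂ] ℂ :=
  LinearMap.mkContinuous₂
    (LinearMap.mk₂ ℂ (fun x y : EllOne N => ∑' j : Mode N, ((j.2 : ℤ) : ℂ) * x j * y j.bar)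
      (fun x x' y => by
        rw [← (summable_symplectic x y).tsum_add (summable_symplectic x' y)]
        exact tsum_congr fun j => by rw [lp.coeFn_add, Pi.add_apply]; ring)
      (fun a x y => by
        rw [smul_eq_mul, ← tsum_mul_left]
        exact tsum_congr fun j => by rw [lp.coeFn_smul, Pi.smul_apply, smul_eq_mul]; ring)
      (fun x y y' => by
        rw [← (summable_symplectic x y).tsum_add (summable_symplectic x y')]
        exact tsum_congr fun j => by rw [lp.coeFn_add, Pi.add_apply]; ring)
      (fun a x y => by
        rw [smul_eq_mul, ← tsum_mul_left]
        exact tsum_congr fun j => by rw [lp.coeFn_smul, Pi.smul_apply, smul_eq_mul]; ring))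
    1 fun x y => by
      rw [one_mul]
      exact tsum_of_norm_bounded ((EllOne.hasSum_norm x).mul_right ‖y‖)
        (norm_symplectic_term_le x y)

theorem symplecticForm_apply (x y : EllOne N) :
    symplecticForm N x y = ∑' j : Mode N, ((j.2 : ℤ) : ℂ) * x j * y j.bar := rfl

theorem norm_symplecticForm_le : ‖symplecticForm N‖ ≤ 1 :=
  LinearMap.mkContinuous₂_norm_le _ zero_le_one _

theorem symplecticForm_skew (x y : EllOne N) : symplecticForm N x y = -symplecticForm N y x := by
  rw [symplecticForm_apply, symplecticForm_apply, ← tsum_neg, ← Mode.barEquiv.tsum_eq]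
  refine tsum_congr fun j => ?_
  change (((Mode.bar j).2 : ℤ) : ℂ) * x (Mode.bar j) * y (Mode.bar (Mode.bar j)) = _
  rw [Mode.bar_bar]
  simp [Mode.bar]
  ring

/-- Hamilton's equations in invariant form, obtained by expanding `v` in coordinate vectors; the
series converges in `ℓ¹`, so the continuous derivative may be applied termwise. -/
theorem fderiv_eval_eq_symplecticForm {k : ℕ} (P : PolyHam N k) (z v : EllOne N) :
    fderiv ℂ P.eval z v = -Complex.I * symplecticForm N v (P.field z) := by
  classical
  have h1 := (lp.hasSum_single (p := 1) (by norm_num) v).mapL (fderiv ℂ P.eval z)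
  rw [← h1.tsum_eq, symplecticForm_apply, ← tsum_mul_left]
  refine tsum_congr fun j => ?_
  have h2 : lp.single 1 j (v j) = v j • (lp.single 1 j (1 : ℂ) : EllOne N) := by
    rw [← lp.single_smul, smul_eq_mul, mul_one]
  rw [P.field_apply_eq_fderiv, Mode.bar_bar, h2, map_smul, smul_eq_mul]
  have h3 : (((Mode.bar j).2 : ℤ) : ℂ) = -((j.2 : ℤ) : ℂ) := by simp [Mode.bar]
  have h4 : ((j.2 : ℤ) : ℂ) * ((j.2 : ℤ) : ℂ) = 1 := by
    rcases Int.units_eq_one_or j.2 with h | h <;> simp [h]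
  rw [h3]
  linear_combination (v j * fderiv ℂ P.eval z (lp.single 1 j 1)) *
    (Complex.I * Complex.I * h4 + Complex.I_mul_I)

/-! ### The real structure -/

/-- The involution `z ↦ (conj z_{j̄})_j`, whose fixed points are the real points. -/
noncomputable def conjBar (N : Set (Fin d → ℤ)) : EllOne N →L[ℝ] EllOne N :=
  LinearMap.mkContinuous
    { toFun := fun z => ⟨fun j => conj (z j.bar), by
        refine memℓp_gen ?_
        have h := (Mode.barEquiv.summable_iff.2 (EllOne.hasSum_norm z).summable)
        simpa [Function.comp_def, Mode.barEquiv] using h⟩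
      map_add' := fun x y => by
        ext j
        change conj ((x + y) (Mode.bar j)) = conj (x (Mode.bar j)) + conj (y (Mode.bar j))
        rw [lp.coeFn_add, Pi.add_apply, map_add]
      map_smul' := fun a x => by
        ext j
        simp }
    1 fun z => by
      rw [one_mul]
      refine le_of_eq ((EllOne.hasSum_norm _).unique ?_)
      have h := (Mode.barEquiv.hasSum_iff.2 (EllOne.hasSum_norm z))
      simpa [Function.comp_def, Mode.barEquiv] using h

theorem conjBar_apply (z : EllOne N) (j : Mode N) : conjBar N z j = conj (z j.bar) := rfl

theorem isRealPoint_iff (z : EllOne N) : IsRealPoint z ↔ conjBar N z = z := by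
  constructor
  · intro h
    ext j
    rw [conjBar_apply, h j, Complex.conj_conj]
  · intro h j
    have := congrArg (fun w : EllOne N => w j.bar) h
    simpa [conjBar_apply, Mode.bar_bar] using this.symm

/-- Reality of the coefficients, `coeff_bar`, after conjugating every index of summation. -/
theorem field_conjBar {k : ℕ} (P : PolyHam N k) (z : EllOne N) :
    P.field (conjBar N z) = conjBar N (P.field z) := by
  ext j
  rw [conjBar_apply, P.field_apply, P.field_apply, map_sum]
  refine Finset.sum_congr rfl fun l _ => ?_
  rw [map_sum]
  refine Finset.sum_congr rfl fun i _ => ?_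
  rw [Complex.conj_tsum, ← (Equiv.piCongrRight fun _ : Fin l => Mode.barEquiv (N := N)).tsum_eq]
  refine tsum_congr fun q => ?_
  change (∏ p, conjBar N z (Mode.bar (q p))) * P.gradCoeff l i (fun p => Mode.bar (q p)) j = _
  have h1 : P.coeff (l + 1) (i.insertNth (Mode.bar j) fun p => Mode.bar (q p)) =
      conj (P.coeff (l + 1) (i.insertNth j q)) := by
    rw [← P.coeff_bar]
    congr 1
    funext p
    refine Fin.succAboveCases i ?_ (fun p => ?_) p <;> simp
  rw [map_mul, map_prod]
  congr 1
  · exact Finset.prod_congr rfl fun p _ => by rw [conjBar_apply, Mode.bar_bar]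
  · rw [PolyHam.gradCoeff, PolyHam.gradCoeff, h1, Mode.bar_bar, map_mul, map_mul]
    simp [Mode.bar]

/-! ### The linear flow -/

section LinearFlow

variable {lam : N → ℝ}

theorem linearFlow_apply (lam : N → ℝ) (z : EllOne N) (j : Mode N) : linearFlow lam z j =
    Complex.exp (-Complex.I * ((j.2 : ℤ) : ℂ) * (lam j.1 : ℂ)) * z j := rfl

theorem norm_exp_phase (lam : N → ℝ) (j : Mode N) :
    ‖Complex.exp (-Complex.I * ((j.2 : ℤ) : ℂ) * (lam j.1 : ℂ))‖ = 1 := by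
  rw [← Complex.norm_exp_ofReal_mul_I (-((j.2 : ℤ) : ℝ) * lam j.1)]
  congr 2
  push_cast
  ring

theorem norm_linearFlow_apply (lam : N → ℝ) (z : EllOne N) (j : Mode N) :
    ‖linearFlow lam z j‖ = ‖z j‖ := by
  rw [linearFlow_apply, norm_mul, norm_exp_phase, one_mul]

theorem norm_linearFlow (lam : N → ℝ) (z : EllOne N) : ‖linearFlow lam z‖ = ‖z‖ := by
  refine (EllOne.hasSum_norm _).unique ?_
  simpa only [norm_linearFlow_apply] using EllOne.hasSum_norm z

/-- The linear flow as a continuous linear map. -/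
noncomputable def linearFlowCLM (lam : N → ℝ) : EllOne N →L[ℂ] EllOne N :=
  LinearMap.mkContinuous
    { toFun := linearFlow lam
      map_add' := fun x y => by
        ext j
        simp [linearFlow_apply, mul_add]
      map_smul' := fun a x => by
        ext j
        simp [linearFlow_apply]
        ring }
    1 fun z => by rw [one_mul]; exact (norm_linearFlow lam z).le

theorem linearFlowCLM_apply (lam : N → ℝ) (z : EllOne N) :
    linearFlowCLM lam z = linearFlow lam z := rfl

/-- The form pairs `j` with `j̄`, whose phases are opposite. -/
theorem symplecticForm_linearFlow (lam : N → ℝ) (x y : EllOne N) :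
    symplecticForm N (linearFlow lam x) (linearFlow lam y) = symplecticForm N x y := by
  rw [symplecticForm_apply, symplecticForm_apply]
  refine tsum_congr fun j => ?_
  have h : Complex.exp (-Complex.I * ((j.2 : ℤ) : ℂ) * (lam j.1 : ℂ)) *
      Complex.exp (-Complex.I * (((Mode.bar j).2 : ℤ) : ℂ) * (lam (Mode.bar j).1 : ℂ)) = 1 := by
    rw [← Complex.exp_add, ← Complex.exp_zero]
    congr 1
    simp [Mode.bar]
  rw [linearFlow_apply, linearFlow_apply]
  linear_combination (((j.2 : ℤ) : ℂ) * x j * y (Mode.bar j)) * h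

theorem isRealPoint_linearFlow {z : EllOne N} (hz : IsRealPoint z) :
    IsRealPoint (linearFlow lam z) := by
  intro j
  rw [linearFlow_apply, linearFlow_apply, hz j, map_mul, ← Complex.exp_conj]
  congr 2
  simp [Mode.bar]

theorem norm_phase (lam : N → ℝ) (j : Mode N) :
    ‖-Complex.I * ((j.2 : ℤ) : ℂ) * (lam j.1 : ℂ)‖ = |lam j.1| := by
  rw [norm_mul, norm_mul, norm_neg, Complex.norm_I, PolyHam.norm_unit, one_mul, one_mul,
    Complex.norm_real, Real.norm_eq_abs]

theorem norm_exp_phase_sub_one_le {μ : ℝ} (hμ : ∀ a, |lam a| ≤ μ) (j : Mode N) :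
    ‖Complex.exp (-Complex.I * ((j.2 : ℤ) : ℂ) * (lam j.1 : ℂ)) - 1‖ ≤ μ := by
  have h := Real.norm_exp_I_mul_ofReal_sub_one_le (x := -((j.2 : ℤ) : ℝ) * lam j.1)
  have h2 : ‖-((j.2 : ℤ) : ℝ) * lam j.1‖ = |lam j.1| := by
    rcases Int.units_eq_one_or j.2 with h | h <;> simp [h]
  rw [h2] at h
  refine le_trans (le_of_eq ?_) (h.trans (hμ j.1))
  congr 3
  push_cast
  ring

theorem norm_linearFlow_sub_le {μ : ℝ} (hμ : ∀ a, |lam a| ≤ μ) (z : EllOne N) :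
    ‖linearFlow lam z - z‖ ≤ μ * ‖z‖ := by
  refine hasSum_le (fun j => ?_) (EllOne.hasSum_norm _) ((EllOne.hasSum_norm z).mul_left μ)
  rw [lp.coeFn_sub, Pi.sub_apply, linearFlow_apply, ← sub_one_mul, norm_mul]
  gcongr
  exact norm_exp_phase_sub_one_le hμ j

/-- The value `∑_j λ_j |z_j|²` of twice the quadratic Hamiltonian at a real point. -/
noncomputable def quadraticAction (lam : N → ℝ) (z : EllOne N) : ℝ :=
  ∑' j : Mode N, lam j.1 * ‖z j‖ ^ 2

theorem sq_norm_apply_le (z : EllOne N) (j : Mode N) : ‖z j‖ ^ 2 ≤ ‖z‖ * ‖z j‖ := by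
  rw [sq]
  gcongr
  exact EllOne.norm_apply_le z j

theorem summable_sq_norm (z : EllOne N) : Summable fun j : Mode N => ‖z j‖ ^ 2 :=
  Summable.of_nonneg_of_le (fun _ => sq_nonneg _) (sq_norm_apply_le z)
    ((EllOne.hasSum_norm z).mul_left ‖z‖).summable

theorem tsum_sq_norm_le (z : EllOne N) : ∑' j : Mode N, ‖z j‖ ^ 2 ≤ ‖z‖ ^ 2 := by
  rw [sq ‖z‖]
  exact hasSum_le (sq_norm_apply_le z) (summable_sq_norm z).hasSum
    ((EllOne.hasSum_norm z).mul_left ‖z‖)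

theorem summable_quadraticAction {μ : ℝ} (hμ : ∀ a, |lam a| ≤ μ) (z : EllOne N) :
    Summable fun j : Mode N => lam j.1 * ‖z j‖ ^ 2 := by
  refine Summable.of_norm_bounded ((summable_sq_norm z).mul_left μ) fun j => ?_
  rw [norm_mul, Real.norm_eq_abs, norm_pow, norm_norm]
  gcongr
  exact hμ _

/-- At a real point `z_j z_{j̄} = |z_j|²`. The first-order term of the phase gives the quadratic
action, and `|e^w - 1 - w| ≤ |w|²` controls the rest. -/
theorem norm_symplecticForm_linearFlow_sub_le {μ : ℝ} (hμ : ∀ a, |lam a| ≤ μ) (hμ1 : μ ≤ 1)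
    {z : EllOne N} (hz : IsRealPoint z) :
    ‖symplecticForm N z (linearFlow lam z - z) - Complex.I * (quadraticAction lam z : ℂ)‖ ≤
      μ ^ 2 * ‖z‖ ^ 2 := by
  have hsum : HasSum (fun j : Mode N => Complex.I * ((lam j.1 * ‖z j‖ ^ 2 : ℝ) : ℂ))
      (Complex.I * (quadraticAction lam z : ℂ)) :=
    (Complex.hasSum_ofReal.2 (summable_quadraticAction hμ z).hasSum).mul_left _
  rw [symplecticForm_apply, ← hsum.tsum_eq,
    ← (summable_symplectic z (linearFlow lam z - z)).tsum_sub hsum.summable]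
  have hb : ∀ j : Mode N, ‖((j.2 : ℤ) : ℂ) * z j * (linearFlow lam z - z) j.bar -
      Complex.I * ((lam j.1 * ‖z j‖ ^ 2 : ℝ) : ℂ)‖ ≤ μ ^ 2 * (‖z‖ * ‖z j‖) := by
    intro j
    set w : ℂ := -Complex.I * (((Mode.bar j).2 : ℤ) : ℂ) * (lam (Mode.bar j).1 : ℂ) with hw
    have h3 : w = Complex.I * ((j.2 : ℤ) : ℂ) * (lam j.1 : ℂ) := by
      rw [hw]
      simp [Mode.bar]
    have hwn : ‖w‖ ≤ μ := (norm_phase lam _).le.trans (hμ _)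
    have h4 : ((j.2 : ℤ) : ℂ) * ((j.2 : ℤ) : ℂ) = 1 := by
      rcases Int.units_eq_one_or j.2 with h | h <;> simp [h]
    have h5 : z j * z (Mode.bar j) = ((‖z j‖ ^ 2 : ℝ) : ℂ) := by
      rw [hz j, Complex.mul_conj, Complex.normSq_eq_norm_sq]
    have h6 : ((j.2 : ℤ) : ℂ) * z j * (linearFlow lam z - z) j.bar -
        Complex.I * ((lam j.1 * ‖z j‖ ^ 2 : ℝ) : ℂ) =
        ((j.2 : ℤ) : ℂ) * ((‖z j‖ ^ 2 : ℝ) : ℂ) * (Complex.exp w - 1 - w) := by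
      rw [lp.coeFn_sub, Pi.sub_apply, linearFlow_apply, ← hw, ← h5, h3, Complex.ofReal_mul, ← h5]
      linear_combination Complex.I * (lam j.1 : ℂ) * z j * z (Mode.bar j) * h4
    rw [h6, norm_mul, norm_mul, PolyHam.norm_unit, one_mul, Complex.norm_real, norm_pow,
      norm_norm, mul_comm]
    gcongr
    · exact (Complex.norm_exp_sub_one_sub_id_le (hwn.trans hμ1)).trans (by gcongr)
    · exact sq_norm_apply_le z j
  refine (tsum_of_norm_bounded (((EllOne.hasSum_norm z).mul_left ‖z‖).mul_left (μ ^ 2)) hb).trans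
    (le_of_eq (by ring))

end LinearFlow

end

section

open Set Metric

/-! ### The almost invariant of one splitting step -/

section OneStep

variable {d : ℕ} {N : Set (Fin d → ℤ)} {k : ℕ} {P : PolyHam N k}

theorem PolyHam.IsFlow.exists_curve {h : ℝ} {z w : EllOne N} (hf : P.IsFlow h z w) :
    ∃ u : ℝ → EllOne N, u 0 = z ∧ u h = w ∧
      ∀ s ∈ Icc 0 h, HasDerivWithinAt u (P.field (u s)) (Icc 0 h) s := by
  obtain ⟨u, v, h0, h1, huv⟩ := hf
  refine ⟨u, h0, h1, fun s hs => ?_⟩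
  have : v s = P.field (u s) := by
    ext j
    rw [(huv s hs).1 j, P.vectorField_eq_field]
  rw [← this]
  exact (huv s hs).2

theorem PolyHam.exists_norm_field_le (P : PolyHam N k) (ρ : ℝ) :
    ∃ C : ℝ, ∀ z, ‖z‖ ≤ ρ → ‖P.field z‖ ≤ C :=
  ⟨_, fun _ hz => P.norm_field_le (le_max_left 1 ρ) (hz.trans (le_max_right 1 ρ))⟩

theorem PolyHam.IsFlow.eq_of_curve {h : ℝ} (hh : 0 ≤ h) {z w : EllOne N} (hf : P.IsFlow h z w)
    {u : ℝ → EllOne N} (hu0 : u 0 = z)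
    (hu : ∀ s ∈ Icc 0 h, HasDerivWithinAt u (P.field (u s)) (Icc 0 h) s) : u h = w := by
  obtain ⟨u', h0, h1, hu'⟩ := hf.exists_curve
  rw [← h1]
  exact eqOn_of_integral_curves (P.contDiff_field.differentiable one_ne_zero)
    P.exists_norm_field_le hu hu' (hu0.trans h0.symm) ⟨hh, le_rfl⟩

/-- The conjugated curve solves the same equation from the same initial point, so uniqueness
applies. -/
theorem PolyHam.IsFlow.isRealPoint {h : ℝ} (hh : 0 ≤ h) {z w : EllOne N} (hf : P.IsFlow h z w)
    (hz : IsRealPoint z) : IsRealPoint w := by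
  obtain ⟨u, h0, h1, hu⟩ := hf.exists_curve
  rw [isRealPoint_iff] at hz ⊢
  rw [← h1]
  refine (hf.eq_of_curve hh (u := fun s => conjBar N (u s)) ?_ fun s hs => ?_).trans h1.symm
  · rw [h0, hz]
  · rw [field_conjBar]
    exact (conjBar N).hasFDerivAt.comp_hasDerivWithinAt s (hu s hs)

theorem norm_actionDensity_le {ρ C D : ℝ} {x : EllOne N} (hx : ‖x‖ ≤ ρ)
    (hX : ‖P.field x‖ ≤ C) (hH : ‖P.eval x‖ ≤ D) :
    ‖actionDensity (symplecticForm N) P.field P.eval x‖ ≤ ρ * C + D := by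
  have hC : 0 ≤ C := (norm_nonneg _).trans hX
  have hρ : 0 ≤ ρ := (norm_nonneg _).trans hx
  rw [actionDensity]
  refine (norm_sub_le _ _).trans ?_
  rw [norm_mul, norm_mul, Complex.norm_I, one_mul]
  have h1 : ‖symplecticForm N x (P.field x)‖ ≤ 1 * ρ * C :=
    ((symplecticForm N).le_opNorm₂ _ _).trans (by gcongr; exact norm_symplecticForm_le)
  have h2 : ‖(1 / 2 : ℂ)‖ = 1 / 2 := by norm_num
  rw [h2]
  nlinarith [norm_nonneg (symplecticForm N x (P.field x)), mul_nonneg hρ hC]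

/-- An almost invariant of one step of the splitting method, close to the quadratic action. -/
theorem exists_almost_invariant {lam : N → ℝ} {r C h ε μ : ℝ} {n : ℕ} (hr : 0 < r) (hh : 0 ≤ h)
    (hXb : ∀ x, ‖x‖ < 4 * r → ‖P.field x‖ ≤ C)
    (hAb : ∀ x, ‖x‖ < 4 * r → ‖actionDensity (symplecticForm N) P.field P.eval x‖ ≤ C)
    (hC : 4 * C * h ≤ r) (hμ : ∀ a, |lam a| ≤ μ) (hμ0 : 0 ≤ μ) (hμ1 : μ ≤ 1)
    (hε : C * h + μ * r ≤ ε) (hn1 : 1 ≤ n) (hn : 240 * n * ε ≤ r) :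
    ∃ I : EllOne N → ℂ,
      (∀ z w, ‖z‖ < r / 2 → P.IsFlow h (linearFlow lam z) w →
        ‖I w - I z‖ ≤ (6 * r ^ 2 + 3 * (C * h)) * (1 / 2) ^ n) ∧
      ∀ z, ‖z‖ < r / 2 → IsRealPoint z →
        ‖I z - Complex.I / 2 * (quadraticAction lam z : ℂ)‖ ≤
          2 * ε ^ 2 + 2 * (C * h) + r * (C * h) + μ ^ 2 * r ^ 2 := by
  have hC0 : 0 ≤ C := (norm_nonneg _).trans (hXb 0 (by simpa using hr))
  have hCh : 0 ≤ C * h := mul_nonneg hC0 hh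
  have hε0 : 0 ≤ ε := le_trans (by positivity) hε
  obtain ⟨Φ, S, hΦ⟩ := exists_hamiltonian_flow P.contDiff_field P.contDiff_eval
    symplecticForm_skew (fderiv_eval_eq_symplecticForm P) hr hh hXb hAb hC
  set L := linearFlowCLM lam
  have hLn : ∀ x, ‖L x‖ = ‖x‖ := norm_linearFlow lam
  have hLr : ∀ x ∈ ball (0 : EllOne N) r, ‖L x‖ < r := fun x hx => by
    rw [hLn]; exact mem_ball_zero_iff.1 hx
  have hF : DifferentiableOn ℂ (fun x => Φ (L x)) (ball 0 r) := fun x hx =>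
    ((hΦ (L x) (hLr x hx)).1.comp x L.differentiableAt).differentiableWithinAt
  have hS : DifferentiableOn ℂ (fun x => S (L x)) (ball 0 r) := fun x hx =>
    ((hΦ (L x) (hLr x hx)).2.1.comp x L.differentiableAt).differentiableWithinAt
  have hLx : ∀ x, ‖L x - x‖ ≤ μ * ‖x‖ := norm_linearFlow_sub_le hμ
  have hFε : ∀ x ∈ ball (0 : EllOne N) r, ‖Φ (L x) - x‖ ≤ ε := by
    intro x hx
    have h1 := (hΦ (L x) (hLr x hx)).2.2.2.1
    have h2 := norm_add_le (Φ (L x) - L x) (L x - x)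
    rw [sub_add_sub_cancel] at h2
    have h3 : μ * ‖x‖ ≤ μ * r := by
      gcongr
      exact (mem_ball_zero_iff.1 hx).le
    linarith [hLx x]
  have hSσ : ∀ x ∈ ball (0 : EllOne N) r, ‖S (L x)‖ ≤ C * h := fun x hx =>
    (hΦ (L x) (hLr x hx)).2.2.2.2.1
  have hFS : ∀ x ∈ ball (0 : EllOne N) r, ∀ v, fderiv ℂ (fun x => S (L x)) x v =
      1 / 2 * symplecticForm N (Φ (L x)) (fderiv ℂ (fun x => Φ (L x)) x v) -
        1 / 2 * symplecticForm N x v := by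
    intro x hx v
    obtain ⟨hd1, hd2, hd3, -⟩ := hΦ (L x) (hLr x hx)
    have h1 : fderiv ℂ (fun x => S (L x)) x v = fderiv ℂ S (L x) (L v) := by
      rw [fderiv_fun_comp x hd2 L.differentiableAt, L.fderiv]
      rfl
    have h2 : fderiv ℂ (fun x => Φ (L x)) x v = fderiv ℂ Φ (L x) (L v) := by
      rw [fderiv_fun_comp x hd1 L.differentiableAt, L.fderiv]
      rfl
    rw [h1, h2, hd3, linearFlowCLM_apply, linearFlowCLM_apply, symplecticForm_linearFlow]
  have hB := norm_symplecticForm_le (N := N)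
  refine ⟨modifiedEnergy (symplecticForm N) (fun x => Φ (L x)) (fun x => S (L x)) n,
    fun z w hz hw => ?_, fun z hz hreal => ?_⟩
  · have hzr : z ∈ ball (0 : EllOne N) r := mem_ball_zero_iff.2 (by linarith)
    obtain ⟨u, hu0, hu1, hu⟩ := (hΦ (L z) (hLr z hzr)).2.2.2.2.2
    have hw' : Φ (L z) = w := hu1 ▸ hw.eq_of_curve hh hu0 fun s hs => (hu s hs).1
    have h1 := norm_modifiedEnergy_comp_sub_le hr hF hε0 hFε hS hSσ hFS hn1 hn
      (mem_ball_zero_iff.2 hz)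
    simp only [hw'] at h1
    refine h1.trans ?_
    gcongr
    nlinarith [sq_nonneg r]
  · have hzr : z ∈ ball (0 : EllOne N) r := mem_ball_zero_iff.2 (by linarith)
    have h1 := norm_modifiedEnergy_sub_le (B := symplecticForm N) hr hF hε0 hFε hS hSσ hn1 hn
      (mem_ball_zero_iff.2 hz)
    have h2 := norm_symplecticForm_linearFlow_sub_le hμ hμ1 hreal
    have h3 : ‖symplecticForm N z (Φ (L z) - L z)‖ ≤ 1 * r * (C * h) := by
      refine ((symplecticForm N).le_opNorm₂ _ _).trans ?_
      gcongr
      · linarith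
      · exact (hΦ (L z) (hLr z hzr)).2.2.2.1
    -- The displacement splits into the nonlinear part, of size `Ch`, and the linear part, which
    -- yields the quadratic action up to `μ²r²`.
    have key : modifiedEnergy (symplecticForm N) (fun x => Φ (L x)) (fun x => S (L x)) n z -
        Complex.I / 2 * (quadraticAction lam z : ℂ) =
        (modifiedEnergy (symplecticForm N) (fun x => Φ (L x)) (fun x => S (L x)) n z -
          1 / 2 * symplecticForm N z (Φ (L z) - z)) +
        (1 / 2 * symplecticForm N z (Φ (L z) - L z) +
          1 / 2 * (symplecticForm N z (linearFlow lam z - z) -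
            Complex.I * (quadraticAction lam z : ℂ))) := by
      have : Φ (L z) - z = (Φ (L z) - L z) + (linearFlow lam z - z) :=
        (sub_add_sub_cancel _ _ _).symm
      rw [this, map_add]
      ring
    rw [key]
    refine (norm_add_le _ _).trans ?_
    have h4 := norm_add_le (1 / 2 * symplecticForm N z (Φ (L z) - L z))
      (1 / 2 * (symplecticForm N z (linearFlow lam z - z) -
            Complex.I * (quadraticAction lam z : ℂ)))
    have hhalf : ‖(1 / 2 : ℂ)‖ = 1 / 2 := by norm_num
    rw [norm_mul, norm_mul, hhalf] at h4
    have h5 : μ ^ 2 * ‖z‖ ^ 2 ≤ μ ^ 2 * r ^ 2 := by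
      gcongr
      linarith
    have h6 : 2 * ‖symplecticForm N‖ * ε ^ 2 ≤ 2 * ε ^ 2 := by nlinarith [sq_nonneg ε]
    have h7 : 0 ≤ r * (C * h) := by positivity
    have h8 : 0 ≤ μ ^ 2 * r ^ 2 := by positivity
    linarith

/-- The quadratic action grows slowly along the trajectories of the splitting method. -/
theorem quadraticAction_le_of_almost_invariant {lam : N → ℝ} {r h δ η : ℝ} (hh : 0 ≤ h)
    {I : EllOne N → ℂ}
    (hI : ∀ z w, ‖z‖ < r / 2 → P.IsFlow h (linearFlow lam z) w → ‖I w - I z‖ ≤ η)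
    (hIQ : ∀ z, ‖z‖ < r / 2 → IsRealPoint z →
      ‖I z - Complex.I / 2 * (quadraticAction lam z : ℂ)‖ ≤ δ)
    {z : ℕ → EllOne N} (hz : ∀ n, P.IsFlow h (linearFlow lam (z n)) (z (n + 1)))
    (hz0 : IsRealPoint (z 0)) (hzr : ∀ n, ‖z n‖ < r / 2) (n : ℕ) :
    quadraticAction lam (z n) ≤ quadraticAction lam (z 0) + 4 * δ + 2 * (n * η) := by
  have hreal : ∀ n, IsRealPoint (z n) := by
    intro n
    induction n with
    | zero => exact hz0
    | succ n ih => exact (hz n).isRealPoint hh (isRealPoint_linearFlow ih)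
  have hsteps : ‖I (z n) - I (z 0)‖ ≤ n * η := by
    induction n with
    | zero => simp
    | succ n ih =>
      have h1 := norm_add_le (I (z (n + 1)) - I (z n)) (I (z n) - I (z 0))
      rw [sub_add_sub_cancel] at h1
      have h2 := hI _ _ (hzr n) (hz n)
      push_cast
      linarith
  have h1 := hIQ _ (hzr n) (hreal n)
  have h2 := hIQ _ (hzr 0) hz0
  have h3 : ‖Complex.I / 2 * ((quadraticAction lam (z n) - quadraticAction lam (z 0) : ℝ) : ℂ)‖
      ≤ 2 * δ + n * η := by
    have h4 : Complex.I / 2 * ((quadraticAction lam (z n) - quadraticAction lam (z 0) : ℝ) : ℂ) =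
        (I (z n) - I (z 0)) - (I (z n) - Complex.I / 2 * (quadraticAction lam (z n) : ℂ)) +
          (I (z 0) - Complex.I / 2 * (quadraticAction lam (z 0) : ℂ)) := by
      push_cast
      ring
    rw [h4]
    refine (norm_add_le _ _).trans ?_
    have := norm_sub_le (I (z n) - I (z 0))
      (I (z n) - Complex.I / 2 * (quadraticAction lam (z n) : ℂ))
    linarith
  rw [norm_mul, norm_div, Complex.norm_I, Complex.norm_real, Real.norm_eq_abs] at h3
  have h5 := le_abs_self (quadraticAction lam (z n) - quadraticAction lam (z 0))
  norm_num at h3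
  linarith

end OneStep

end

/-! ### Comparison of the quadratic action with the weighted sums -/

section

open Set

theorem arctan_le_self {x : ℝ} (hx : 0 ≤ x) : Real.arctan x ≤ x := by
  have h := image_sub_le_mul_sub_of_deriv_le Real.differentiable_arctan (C := 1)
    (fun y => by
      rw [Real.deriv_arctan, div_le_one (by positivity)]
      nlinarith [sq_nonneg y]) hx
  simpa using h

theorem div_le_arctan {b x : ℝ} (hx : 0 ≤ x) (hxb : x ≤ b) : x / (1 + b ^ 2) ≤ Real.arctan x := by
  have h := (convex_Icc 0 b).mul_sub_le_image_sub_of_le_deriv (C := 1 / (1 + b ^ 2))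
    Real.continuous_arctan.continuousOn Real.differentiable_arctan.differentiableOn
    (fun y hy => by
      rw [interior_Icc] at hy
      rw [Real.deriv_arctan]
      have h1 : y ^ 2 ≤ b ^ 2 := pow_le_pow_left₀ hy.1.le hy.2.le 2
      exact one_div_le_one_div_of_le (by positivity) (by linarith))
    0 ⟨le_rfl, hx.trans hxb⟩ x ⟨hx, hxb⟩ hx
  simp only [sub_zero, Real.arctan_zero] at h
  rwa [one_div_mul_eq_div] at h

theorem Mode.one_le_abs {d : ℕ} {N : Set (Fin d → ℤ)} (j : Mode N) : 1 ≤ j.abs := by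
  rw [Mode.abs, latticeAbs, ← Real.sqrt_one]
  exact Real.sqrt_le_sqrt (by rw [Real.sqrt_one]; exact le_max_left _ _)

section Weights

variable {d : ℕ} {N : Set (Fin d → ℤ)}

/-- The factor `1` is the value of `α` chosen in the theorem. At the cutoff `|j|^m = 1/√h`, so `√h
ω_a` is between `1/b` and `b`, where the arctangent leaves its linear regime. -/
theorem cutoff_rpow {h m : ℝ} (hh : 0 < h) (hm : 0 < m) :
    (1 * h ^ (-(1 / (2 * m)))) ^ m = 1 / Real.sqrt h := by
  rw [one_mul, ← Real.rpow_mul hh.le, show -(1 / (2 * m)) * m = -(1 / 2) by field_simp,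
    Real.rpow_neg hh.le, Real.sqrt_eq_rpow, one_div, one_div]

theorem abs_rpow_le_of_low {h m : ℝ} (hh : 0 < h) (hm : 0 < m) {j : Mode N}
    (hj : j.abs < 1 * h ^ (-(1 / (2 * m)))) : j.abs ^ m ≤ 1 / Real.sqrt h := by
  rw [← cutoff_rpow hh hm]
  exact Real.rpow_le_rpow (zero_le_one.trans j.one_le_abs) hj.le hm.le

theorem le_abs_rpow_of_high {h m : ℝ} (hh : 0 < h) (hm : 0 < m) {j : Mode N}
    (hj : 1 * h ^ (-(1 / (2 * m))) ≤ j.abs) : 1 / Real.sqrt h ≤ j.abs ^ m := by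
  rw [← cutoff_rpow hh hm]
  exact Real.rpow_le_rpow (by positivity) hj hm.le

theorem weighted_sums_le {h m A : ℝ} (hh : 0 < h) (z : EllOne N) {g : Mode N → ℝ}
    (hg : Summable g)
    (hlow : ∀ j : Mode N, j.abs < A → j.abs ^ m * ‖z j‖ ^ 2 ≤ g j)
    (hhigh : ∀ j : Mode N, A ≤ j.abs → 1 / Real.sqrt h * ‖z j‖ ^ 2 ≤ g j) :
    (Summable fun j : {j : Mode N // j.abs < A} => j.1.abs ^ m * ‖z j.1‖ ^ 2) ∧
      (Summable fun j : {j : Mode N // A ≤ j.abs} => ‖z j.1‖ ^ 2) ∧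
      (∑' j : {j : Mode N // j.abs < A}, j.1.abs ^ m * ‖z j.1‖ ^ 2) +
        1 / Real.sqrt h * (∑' j : {j : Mode N // A ≤ j.abs}, ‖z j.1‖ ^ 2) ≤ ∑' j, g j := by
  have hs : 0 < Real.sqrt h := Real.sqrt_pos.2 hh
  have hcompl : {j : Mode N | A ≤ j.abs} = {j : Mode N | j.abs < A}ᶜ := by
    ext j
    simp
  have hg1 : Summable fun j : {j : Mode N // j.abs < A} => g j.1 :=
    hg.subtype {j : Mode N | j.abs < A}
  have hg2 : Summable fun j : {j : Mode N // A ≤ j.abs} => g j.1 :=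
    hg.subtype {j : Mode N | A ≤ j.abs}
  have h1 : Summable fun j : {j : Mode N // j.abs < A} => j.1.abs ^ m * ‖z j.1‖ ^ 2 :=
    Summable.of_nonneg_of_le
      (fun j => mul_nonneg (Real.rpow_nonneg (zero_le_one.trans j.1.one_le_abs) _) (sq_nonneg _))
      (fun j => hlow j.1 j.2) hg1
  have h2 : Summable fun j : {j : Mode N // A ≤ j.abs} => ‖z j.1‖ ^ 2 :=
    (summable_sq_norm z).subtype {j : Mode N | A ≤ j.abs}
  refine ⟨h1, h2, ?_⟩
  have h3 : (∑' j : {j : Mode N // j.abs < A}, g j.1) + (∑' j : {j : Mode N // A ≤ j.abs}, g j.1)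
      = ∑' j, g j := by
    have h4 : HasSum (fun j : ({j : Mode N | j.abs < A}ᶜ : Set (Mode N)) => g j.1)
        (∑' j : {j : Mode N // A ≤ j.abs}, g j.1) := by
      rw [← hcompl]
      exact hg2.hasSum
    exact ((HasSum.add_compl (s := {j : Mode N | j.abs < A}) hg1.hasSum h4).tsum_eq).symm
  rw [← h3, ← tsum_mul_left]
  exact add_le_add (h1.tsum_le_tsum (fun j => hlow j.1 j.2) hg1)
    ((h2.mul_left _).tsum_le_tsum (fun j => hhigh j.1 j.2) hg2)

variable {ω : N → ℝ} {b m h : ℝ}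

theorem abs_filterFun_le (x : ℝ) : |filterFun h x| ≤ 2 * Real.sqrt h := by
  rw [filterFun, abs_mul, abs_of_nonneg (Real.sqrt_nonneg h), mul_comm]
  gcongr
  have h1 := Real.arctan_lt_pi_div_two (x / Real.sqrt h)
  have h2 := Real.neg_pi_div_two_lt_arctan (x / Real.sqrt h)
  have h3 := Real.pi_le_four
  rw [abs_le]
  constructor <;> linarith

theorem filterFun_mul_eq (hh : 0 < h) (x : ℝ) :
    filterFun h (h * x) = Real.sqrt h * Real.arctan (Real.sqrt h * x) := by
  have hs : 0 < Real.sqrt h := Real.sqrt_pos.2 hh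
  rw [filterFun]
  congr 2
  rw [div_eq_iff hs.ne', mul_right_comm, Real.mul_self_sqrt hh.le]

theorem filterFun_mul_le (hh : 0 < h) {x : ℝ} (hx : 0 ≤ x) : filterFun h (h * x) ≤ h * x := by
  rw [filterFun_mul_eq hh]
  calc Real.sqrt h * Real.arctan (Real.sqrt h * x) ≤ Real.sqrt h * (Real.sqrt h * x) := by
        gcongr
        exact arctan_le_self (by positivity)
    _ = h * x := by rw [← mul_assoc, Real.mul_self_sqrt hh.le]

/-- Below the cutoff `√h x ≤ b`, and on `[0, b]` the arctangent is at least linear with slope `1 /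
(1 + b²)`. -/
theorem filterFun_mul_ge_low (hh : 0 < h) (hb : 1 ≤ b) {x y : ℝ} (hy : 0 ≤ y)
    (hyh : y ≤ 1 / Real.sqrt h) (hx1 : 1 / b * y ≤ x) (hx2 : x ≤ b * y) :
    h * (1 / (b * (1 + b ^ 2)) * y) ≤ filterFun h (h * x) := by
  have hs : 0 < Real.sqrt h := Real.sqrt_pos.2 hh
  rw [filterFun_mul_eq hh]
  have hx0 : 0 ≤ x := le_trans (by positivity) hx1
  have hxb : Real.sqrt h * x ≤ b := by
    calc Real.sqrt h * x ≤ Real.sqrt h * (b * (1 / Real.sqrt h)) := by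
          gcongr
          exact hx2.trans (by gcongr)
      _ = b := by field_simp
  calc h * (1 / (b * (1 + b ^ 2)) * y)
      = Real.sqrt h * (Real.sqrt h * (1 / b * y) / (1 + b ^ 2)) := by
        nth_rewrite 1 [← Real.mul_self_sqrt hh.le]
        field_simp
    _ ≤ Real.sqrt h * (Real.sqrt h * x / (1 + b ^ 2)) := by gcongr
    _ ≤ _ := by
        gcongr
        exact div_le_arctan (by positivity) hxb

/-- Above the cutoff `√h x ≥ 1/b`, so monotonicity bounds the arctangent below by its value at
`1/b`. -/
theorem filterFun_mul_ge_high (hh : 0 < h) (hb : 1 ≤ b) {x y : ℝ}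
    (hyh : 1 / Real.sqrt h ≤ y) (hx1 : 1 / b * y ≤ x) :
    h * (1 / (b * (1 + b ^ 2)) * (1 / Real.sqrt h)) ≤ filterFun h (h * x) := by
  have hs : 0 < Real.sqrt h := Real.sqrt_pos.2 hh
  rw [filterFun_mul_eq hh]
  have hxb : 1 / b ≤ Real.sqrt h * x := by
    calc 1 / b = Real.sqrt h * (1 / b * (1 / Real.sqrt h)) := by field_simp
      _ ≤ Real.sqrt h * (1 / b * y) := by gcongr
      _ ≤ _ := by gcongr
  have hbb : 1 / b ≤ b := by
    rw [div_le_iff₀ (by linarith)]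
    nlinarith
  calc h * (1 / (b * (1 + b ^ 2)) * (1 / Real.sqrt h))
      = Real.sqrt h * (1 / b / (1 + b ^ 2)) := by
        nth_rewrite 1 [← Real.mul_self_sqrt hh.le]
        field_simp
    _ ≤ Real.sqrt h * Real.arctan (1 / b) := by
        gcongr
        exact div_le_arctan (by positivity) hbb
    _ ≤ _ := by
        gcongr

/-- The quadratic action controls the weighted sums over low and high modes. -/
theorem weighted_sums_le_quadraticAction (hm : 0 < m) (hb : 1 ≤ b) (hh : 0 < h)
    (hω : ∀ a : N, 1 / b * latticeAbs (a : Fin d → ℤ) ^ m ≤ ω a ∧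
      ω a ≤ b * latticeAbs (a : Fin d → ℤ) ^ m) {Q : ℝ} (z : EllOne N)
    (hQ : quadraticAction (fun a => filterFun h (h * ω a)) z ≤ h * Q) :
    (Summable fun j : {j : Mode N // j.abs < 1 * h ^ (-(1 / (2 * m)))} =>
        j.1.abs ^ m * ‖z j.1‖ ^ 2) ∧
      (Summable fun j : {j : Mode N // 1 * h ^ (-(1 / (2 * m))) ≤ j.abs} => ‖z j.1‖ ^ 2) ∧
      (∑' j : {j : Mode N // j.abs < 1 * h ^ (-(1 / (2 * m)))}, j.1.abs ^ m * ‖z j.1‖ ^ 2) +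
        1 / Real.sqrt h *
          (∑' j : {j : Mode N // 1 * h ^ (-(1 / (2 * m))) ≤ j.abs}, ‖z j.1‖ ^ 2) ≤
        b * (1 + b ^ 2) * Q := by
  set κ := b * (1 + b ^ 2) with hκ
  have hκ0 : 0 < κ := by positivity
  have hsum := summable_quadraticAction (lam := fun a => filterFun h (h * ω a))
    (fun a => abs_filterFun_le _) z
  have hscale : ∀ {y w t : ℝ}, 0 ≤ t → h * (1 / κ * y) ≤ w → y * t ≤ κ / h * (w * t) := by
    intro y w t ht hyw
    have : y ≤ κ / h * w := by
      calc y = κ / h * (h * (1 / κ * y)) := by field_simp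
        _ ≤ κ / h * w := by gcongr
    rw [← mul_assoc]
    gcongr
  have key := weighted_sums_le (m := m) (A := 1 * h ^ (-(1 / (2 * m)))) hh z
    (hsum.mul_left (κ / h))
    (fun j hj => hscale (sq_nonneg _) (filterFun_mul_ge_low hh hb
      (Real.rpow_nonneg (zero_le_one.trans j.one_le_abs) _) (abs_rpow_le_of_low hh hm hj)
      (hω j.1).1 (hω j.1).2))
    (fun j hj => hscale (sq_nonneg _) (filterFun_mul_ge_high hh hb (le_abs_rpow_of_high hh hm hj)
      (hω j.1).1))
  refine ⟨key.1, key.2.1, key.2.2.trans ?_⟩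
  rw [tsum_mul_left]
  calc κ / h * quadraticAction (fun a => filterFun h (h * ω a)) z ≤ κ / h * (h * Q) := by gcongr
    _ = κ * Q := by field_simp

theorem quadraticAction_le_of_sobolevNorm_le {R : ℝ} (hb : 1 ≤ b) (hh : 0 < h)
    (hω : ∀ a : N, 1 / b * latticeAbs (a : Fin d → ℤ) ^ m ≤ ω a ∧
      ω a ≤ b * latticeAbs (a : Fin d → ℤ) ^ m) {z : EllOne N}
    (hz : MemSobolev (m / 2) z) (hR : sobolevNorm (m / 2) z ≤ R) :
    quadraticAction (fun a => filterFun h (h * ω a)) z ≤ h * (b * R ^ 2) := by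
  have hsum := summable_quadraticAction (lam := fun a => filterFun h (h * ω a))
    (fun a => abs_filterFun_le _) z
  rw [MemSobolev] at hz
  rw [sobolevNorm] at hR
  have hle : ∑' j : Mode N, j.abs ^ (2 * (m / 2)) * ‖z j‖ ^ 2 ≤ R ^ 2 :=
    (Real.sqrt_le_left ((Real.sqrt_nonneg _).trans hR)).1 hR
  calc quadraticAction (fun a => filterFun h (h * ω a)) z
      ≤ ∑' j : Mode N, h * b * (j.abs ^ (2 * (m / 2)) * ‖z j‖ ^ 2) := by
        refine hsum.tsum_le_tsum (fun j => ?_) (hz.mul_left _)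
        rw [← mul_assoc, show 2 * (m / 2) = m by ring]
        gcongr
        have h0 : 0 ≤ ω j.1 := le_trans (mul_nonneg (by positivity)
          (Real.rpow_nonneg (Real.sqrt_nonneg _) _)) (hω j.1).1
        refine (filterFun_mul_le hh h0).trans ?_
        rw [mul_assoc]
        gcongr
        exact (hω j.1).2
    _ ≤ h * b * R ^ 2 := by
        rw [tsum_mul_left]
        gcongr
    _ = _ := by ring

/-- The weighted sums over low and high modes are trivially bounded for a fixed step size. -/
theorem weighted_sums_le_norm (hm : 0 < m) (hh : 0 < h) (z : EllOne N) :
    (Summable fun j : {j : Mode N // j.abs < 1 * h ^ (-(1 / (2 * m)))} =>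
        j.1.abs ^ m * ‖z j.1‖ ^ 2) ∧
      (Summable fun j : {j : Mode N // 1 * h ^ (-(1 / (2 * m))) ≤ j.abs} => ‖z j.1‖ ^ 2) ∧
      (∑' j : {j : Mode N // j.abs < 1 * h ^ (-(1 / (2 * m)))}, j.1.abs ^ m * ‖z j.1‖ ^ 2) +
        1 / Real.sqrt h *
          (∑' j : {j : Mode N // 1 * h ^ (-(1 / (2 * m))) ≤ j.abs}, ‖z j.1‖ ^ 2) ≤
        1 / Real.sqrt h * ‖z‖ ^ 2 := by
  have key := weighted_sums_le (m := m) (A := 1 * h ^ (-(1 / (2 * m)))) hh z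
    ((summable_sq_norm z).mul_left (1 / Real.sqrt h))
    (fun j hj => by gcongr; exact abs_rpow_le_of_low hh hm hj) (fun j _ => le_rfl)
  refine ⟨key.1, key.2.1, key.2.2.trans ?_⟩
  rw [tsum_mul_left]
  gcongr
  exact tsum_sq_norm_le z

end Weights

/-- An exponentially small error stays small over exponentially long times. -/
theorem steps_mul_error_le {A h : ℝ} (hA : 0 < A) (hh : 0 < h) {n p : ℕ}
    (hp : A / Real.sqrt h ≤ p + 1) (hn : n * h ≤ Real.exp (A / 4 * h ^ (-(1 / 2) : ℝ))) :
    n * (1 / 2 : ℝ) ^ p ≤ 48 / (A / 4) ^ 4 * h := by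
  have hs : 0 < Real.sqrt h := Real.sqrt_pos.2 hh
  have hrpow : h ^ (-(1 / 2) : ℝ) = 1 / Real.sqrt h := by
    rw [Real.rpow_neg hh.le, ← Real.sqrt_eq_rpow, one_div]
  rw [hrpow, mul_one_div] at hn
  set x := A / 4 / Real.sqrt h with hx
  have hx0 : 0 < x := by positivity
  -- With `4x = A/√h` and `log 2 ≥ 1/2`, the step error beats the allowed time `e^x` by another
  -- factor `e^{-x}`.
  have hp2 : (1 / 2 : ℝ) ^ p ≤ 2 * Real.exp (-(2 * x)) := by
    have hlog : (1 / 2 : ℝ) ≤ Real.log 2 := by linarith [Real.log_two_gt_d9]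
    have h1 : (1 / 2 : ℝ) ^ (p + 1) = Real.exp (-((p + 1 : ℕ) * Real.log 2)) := by
      rw [Real.exp_neg, Real.exp_nat_mul, Real.exp_log two_pos, one_div, inv_pow]
    have h2 : 2 * x ≤ (p + 1 : ℕ) * Real.log 2 := by
      have h3 : 4 * x = A / Real.sqrt h := by rw [hx]; ring
      push_cast
      nlinarith
    have h4 : (1 / 2 : ℝ) ^ (p + 1) ≤ Real.exp (-(2 * x)) := by
      rw [h1]
      exact Real.exp_le_exp.2 (neg_le_neg h2)
    rw [pow_succ] at h4
    linarith
  -- The fourth power is needed because `x⁻⁴` is of order `h²`: one power of `h` pays for the number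
  -- of steps `e^x / h`, and one remains.
  have hxexp : Real.exp (-x) ≤ 24 / x ^ 4 := by
    have h1 := Real.pow_div_factorial_le_exp x hx0.le 4
    have h2 : ((Nat.factorial 4 : ℕ) : ℝ) = 24 := by norm_num [Nat.factorial]
    rw [h2] at h1
    rw [Real.exp_neg, inv_le_comm₀ (Real.exp_pos _) (by positivity), inv_div]
    exact h1
  have hx4 : x ^ 4 = (A / 4) ^ 4 / h ^ 2 := by
    rw [hx, div_pow, show Real.sqrt h ^ 4 = (Real.sqrt h ^ 2) ^ 2 by ring, Real.sq_sqrt hh.le]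
  have hnle : (n : ℝ) ≤ Real.exp x / h := (le_div_iff₀ hh).2 hn
  calc n * (1 / 2 : ℝ) ^ p ≤ Real.exp x / h * (2 * Real.exp (-(2 * x))) := by gcongr
    _ = 2 / h * Real.exp (-x) := by
        rw [show -x = x + -(2 * x) by ring, Real.exp_add]
        ring
    _ ≤ 2 / h * (24 / x ^ 4) := by gcongr
    _ = _ := by
        rw [hx4]
        field_simp
        norm_num

end

/-! ### Choice of constants and conclusion -/

section Final

variable {d : ℕ} {N : Set (Fin d → ℤ)} {k : ℕ}

theorem PolyHam.norm_field_le_of_norm_le {P : PolyHam N k} {K ρ : ℝ} (hP : P.norm ≤ K)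
    (hρ : 1 ≤ ρ) {z : EllOne N} (hz : ‖z‖ ≤ ρ) :
    ‖P.field z‖ ≤ k * (k * (2 * K * ρ ^ k)) :=
  (P.norm_field_le hρ hz).trans (by gcongr)

theorem PolyHam.norm_eval_le_of_norm_le {P : PolyHam N k} {K ρ : ℝ} (hP : P.norm ≤ K)
    (hρ : 1 ≤ ρ) {z : EllOne N} (hz : ‖z‖ ≤ ρ) : ‖P.eval z‖ ≤ k * (K * ρ ^ k) :=
  (P.norm_eval_le hρ hz).trans (by gcongr)

/-- For small step sizes, the quadratic action stays of the order of the step size over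
exponentially long times, uniformly in the Hamiltonian and the frequencies. -/
theorem exists_quadraticAction_le (N : Set (Fin d → ℤ)) (k : ℕ) (b K R : ℝ) {M : ℝ}
    (hM : 0 < M) :
    ∃ h₀ c Q : ℝ, 0 < h₀ ∧ 0 < c ∧ ∀ (P : PolyHam N k) (ω : N → ℝ) (h : ℝ) (z : ℕ → EllOne N),
      P.norm ≤ K → 0 < h → h ≤ h₀ → IsSplittingTrajectory P ω h z → IsRealPoint (z 0) →
      (∀ n, ‖z n‖ ≤ M) →
      quadraticAction (fun a => filterFun h (h * ω a)) (z 0) ≤ h * (b * R ^ 2) →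
      ∀ n : ℕ, (n : ℝ) * h ≤ Real.exp (c * h ^ (-(1 / 2) : ℝ)) →
        quadraticAction (fun a => filterFun h (h * ω a)) (z n) ≤ h * Q := by
  -- All iterates then lie strictly inside the ball of radius `r/2`, where the modified energy is
  -- controlled.
  set r := 3 * max M 1 with hr
  have hr3 : 3 ≤ r := by rw [hr]; linarith [le_max_right M 1]
  have hrM : M < r / 2 := by rw [hr]; linarith [le_max_left M 1]
  set K₁ := max K 0
  have hK₁ : 0 ≤ K₁ := le_max_right _ _
  set ρ := 4 * r with hρ
  have hρ1 : 1 ≤ ρ := by linarith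
  set CX := k * (k * (2 * K₁ * ρ ^ k)) with hCX
  set CH := k * (K₁ * ρ ^ k) with hCH
  have hCX0 : 0 ≤ CX := by positivity
  have hCH0 : 0 ≤ CH := by positivity
  set C₀ := ρ * CX + CH + 1 with hC₀
  have hC₀1 : 1 ≤ C₀ := by
    have : 0 ≤ ρ * CX := by positivity
    linarith
  have hCXC₀ : CX ≤ C₀ := by nlinarith
  -- `Cε √h` bounds the distance of one step from the identity, and `A/√h` is the largest truncation
  -- order compatible with `240nε ≤ r`.
  set Cε := C₀ + 2 * r with hCε
  have hCε0 : 0 < Cε := by linarith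
  set A := r / (240 * Cε) with hA
  have hA0 : 0 < A := by positivity
  set η := 6 * r ^ 2 + 3 * C₀ with hη
  have hη0 : 0 ≤ η := by positivity
  -- The three bounds on `h` ensure, in order, that the flow exists up to time `h`, that the phases
  -- satisfy `2√h ≤ 1`, and that the truncation order is at least one.
  refine ⟨min (r / (4 * C₀)) (min (1 / 4) (A ^ 2)), A / 4,
    b * R ^ 2 + 4 * (2 * Cε ^ 2 + 2 * C₀ + r * C₀ + 4 * r ^ 2) + 2 * (η * (48 / (A / 4) ^ 4)),
    by positivity, by positivity, ?_⟩
  intro P ω h z hP hh hh₀ htraj hreal hzM hQ0 n hn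
  rw [le_min_iff, le_min_iff] at hh₀
  obtain ⟨hh1, hh2, hh3⟩ := hh₀
  have hPK : P.norm ≤ K₁ := hP.trans (le_max_left _ _)
  set s := Real.sqrt h with hsdef
  have hs : 0 < s := Real.sqrt_pos.2 hh
  have hss : s * s = h := Real.mul_self_sqrt hh.le
  have hs2 : s ≤ 1 / 2 := by nlinarith
  have hsA : s ≤ A := Real.sqrt_le_iff.2 ⟨hA0.le, hh3⟩
  set p := ⌊A / s⌋₊ with hp
  have hp1 : 1 ≤ p := Nat.one_le_floor_iff _ |>.2 ((one_le_div hs).2 hsA)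
  have hpA1 : A / s ≤ p + 1 := (Nat.lt_floor_add_one _).le
  have hpA : (p : ℝ) * s ≤ A := (le_div_iff₀ hs).1 (Nat.floor_le (by positivity))
  have hX : ∀ x : EllOne N, ‖x‖ < 4 * r → ‖P.field x‖ ≤ CX := fun x hx =>
    P.norm_field_le_of_norm_le hPK hρ1 hx.le
  have hC4 : 4 * C₀ * h ≤ r := by
    rw [le_div_iff₀ (by positivity)] at hh1
    linarith
  have hAb : ∀ x : EllOne N, ‖x‖ < 4 * r →
      ‖actionDensity (symplecticForm N) P.field P.eval x‖ ≤ C₀ := fun x hx =>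
    (norm_actionDensity_le hx.le (hX x hx) (P.norm_eval_le_of_norm_le hPK hρ1 hx.le)).trans
      (le_add_of_nonneg_right zero_le_one)
  have hε : C₀ * h + 2 * s * r ≤ Cε * s := by
    have : C₀ * h ≤ C₀ * s := mul_le_mul_of_nonneg_left (by nlinarith) (by linarith)
    rw [hCε]
    linarith
  have hpr : 240 * (p : ℝ) * (Cε * s) ≤ r := by
    calc 240 * (p : ℝ) * (Cε * s) = 240 * Cε * (p * s) := by ring
      _ ≤ 240 * Cε * A := by gcongr
      _ = r := by rw [hA]; field_simp
  have hs1 : 2 * s ≤ 1 := by linarith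
  clear_value η C₀ Cε A p s r
  obtain ⟨I, hI, hIQ⟩ := exists_almost_invariant (P := P)
    (lam := fun a => filterFun h (h * ω a)) (zero_lt_three.trans_le hr3) hh.le
    (fun x hx => (hX x hx).trans hCXC₀) hAb hC4
    (fun a => (abs_filterFun_le _).trans_eq (by rw [hsdef])) (mul_nonneg zero_le_two hs.le) hs1
    hε hp1 hpr
  have h1 := quadraticAction_le_of_almost_invariant hh.le hI hIQ htraj hreal
    (fun n => (hzM n).trans_lt hrM) n
  have h2 := steps_mul_error_le hA0 hh (hsdef ▸ hpA1) hn
  have hh1' : h ≤ 1 := by linarith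
  have hCh : C₀ * h ≤ C₀ := mul_le_of_le_one_right (zero_le_one.trans hC₀1) hh1'
  have hη1 : 6 * r ^ 2 + 3 * (C₀ * h) ≤ η := by linarith
  have h3 : n * ((6 * r ^ 2 + 3 * (C₀ * h)) * (1 / 2 : ℝ) ^ p) ≤
      η * (48 / (A / 4) ^ 4 * h) := by
    rw [mul_left_comm]
    exact mul_le_mul hη1 h2 (by positivity) hη0
  have h4 : (Cε * s) ^ 2 = Cε ^ 2 * h := by rw [← hss]; ring
  have h5 : (2 * s) ^ 2 = 4 * h := by rw [← hss]; ring
  rw [h4, h5] at h1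
  linarith

end Final

theorem mainTheorem8 (d : ℕ) (hd : 1 ≤ d) (N : Set (Fin d → ℤ)) (hN : IsModeLattice N)
    (r₀ : ℕ) (hr₀ : 3 ≤ r₀) (m b K M R : ℝ) (hm : 0 < m) (hb : 1 ≤ b) :
    ∃ C α c : ℝ, 0 < C ∧ 0 < α ∧ 0 < c ∧
      ∀ ω : N → ℝ,
        (∀ a : N, 1 / b * latticeAbs (a : Fin d → ℤ) ^ m ≤ ω a ∧
          ω a ≤ b * latticeAbs (a : Fin d → ℤ) ^ m) →
      ∀ P : PolyHam N r₀, P.norm ≤ K →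
      ∀ h : ℝ, 0 < h →
      ∀ z : ℕ → EllOne N,
        IsRealPoint (z 0) →
        MemSobolev (m / 2) (z 0) → sobolevNorm (m / 2) (z 0) ≤ R →
        IsSplittingTrajectory P ω h z →
        (∀ n, ‖z n‖ ≤ M) →
      ∀ n : ℕ, (n : ℝ) * h ≤ Real.exp (c * h ^ (-(1 / 2) : ℝ)) →
        (Summable fun j : {j : Mode N // j.abs < α * h ^ (-(1 / (2 * m)))} =>
          j.1.abs ^ m * ‖z n j.1‖ ^ 2) ∧
        (Summable fun j : {j : Mode N // α * h ^ (-(1 / (2 * m))) ≤ j.abs} =>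
          ‖z n j.1‖ ^ 2) ∧
        (∑' j : {j : Mode N // j.abs < α * h ^ (-(1 / (2 * m)))},
            j.1.abs ^ m * ‖z n j.1‖ ^ 2)
          + 1 / Real.sqrt h *
            (∑' j : {j : Mode N // α * h ^ (-(1 / (2 * m))) ≤ j.abs}, ‖z n j.1‖ ^ 2) ≤ C := by
  have hM₁ : 0 < max M 1 := zero_lt_one.trans_le (le_max_right _ _)
  obtain ⟨h₀, c, Q, hh₀, hc, key⟩ := exists_quadraticAction_le N r₀ b K R hM₁
  -- The first entry of the maximum serves `h ≤ h₀`; the second, from the `ℓ¹` bound alone, serves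
  -- `h ≥ h₀`. Using `max M 1` makes `C` positive whatever `M` is.
  refine ⟨max (b * (1 + b ^ 2) * Q) (1 / Real.sqrt h₀ * max M 1 ^ 2), 1, c,
    lt_max_of_lt_right (by positivity), one_pos, hc, ?_⟩
  intro ω hω P hP h hh z hreal hz0 hR htraj hzM n hn
  have hzM₁ : ∀ n, ‖z n‖ ≤ max M 1 := fun n => (hzM n).trans (le_max_left _ _)
  rcases le_total h h₀ with hle | hle
  · have h1 := weighted_sums_le_quadraticAction hm hb hh hω (z n) (key P ω h z hP hh hle htraj
      hreal hzM₁ (quadraticAction_le_of_sobolevNorm_le hb hh hω hz0 hR) n hn)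
    exact ⟨h1.1, h1.2.1, h1.2.2.trans (le_max_left _ _)⟩
  · have h1 := weighted_sums_le_norm hm hh (z n)
    refine ⟨h1.1, h1.2.1, h1.2.2.trans (le_max_of_le_right ?_)⟩
    gcongr
    exact hzM₁ n
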